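/- Let $d\ge 3$ be an integer and let $A_d^{(2)}$ be the configuration of the $d+1$ lattice points $\mathbf a_j=\bigl(j,\binom j2\bigr)\in\mathbb Z^2$, $j=0,\dots,d$. For a finite configuration $B=\{\mathbf b_i\}_{i\in I}\subset\mathbb Z^2$ let $X_B\subset\mathbb P^{|I|-1}$ be the complex projective toric variety obtained as the Zariski closure of the image of $(\mathbb C^*)^2\to\mathbb P^{|I|-1}$, $\mathbf t\mapsto(\mathbf t^{\mathbf b_i})_{i\in I}$, with the diagonal torus action $\mathbf t*(x_i)_i=(\mathbf t^{\mathbf b_i}x_i)_i$. (The surface $X_{A_d^{(2)}}\subset\mathbb P^d$ is called the second toric interpolant of the rational normal curve of degree $d$.) Let $\overline{A_d^{(2)}}$ be the configuration of all lattice points in the convex hull of $A_d^{(2)}$, and let $N+1$ be their number, so that $X_{\overline{A_d^{(2)}}}\subset\mathbb P^N$. Then: 1. The degree of $X_{A_d^{(2)}}\subset\mathbb P^d$ is $\binom{d+1}3$. 2. The linear projection $\mathbb P^N\dashrightarrow\mathbb P^d$ that keeps exactly the coordinates indexed by the points of $A_d^{(2)}$ is defined at every point of $X_{\overline{A_d^{(2)}}}$,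 commutes with the torus actions, and maps $X_{\overline{A_d^{(2)}}}$ onto $X_{A_d^{(2)}}$; this morphism $X_{\overline{A_d^{(2)}}}\to X_{A_d^{(2)}}$ is the normalization of $X_{A_d^{(2)}}$, i.e. it is finite and birational and $X_{\overline{A_d^{(2)}}}$ is normal. 3. $N=\frac1{12}d(d^2+8)$ if $d$ is even, and $N=\frac1{12}d(d^2+11)$ if $d$ is odd. -/

import Mathlib

open scoped LinearAlgebra.Projectivization

noncomputable section

namespace ToricInterpolation

/-! ### Projective algebraic sets over `ℂ`

`ℙ ℂ (ι → ℂ)` is the projective space with homogeneous coordinates indexed by `ι`; it is `ℙ^N` when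
`ι` has `N + 1` elements. -/

/-- The Zariski closure of a set of points of projective space: the common zeros of all homogeneous
polynomials that vanish on it. -/
def zariskiClosure {ι : Type*} (S : Set (ℙ ℂ (ι → ℂ))) : Set (ℙ ℂ (ι → ℂ)) :=
  {p | ∀ (n : ℕ) (f : MvPolynomial ι ℂ), f.IsHomogeneous n →
    (∀ q ∈ S, MvPolynomial.eval q.rep f = 0) → MvPolynomial.eval p.rep f = 0}

/-- The degree `n` part of the homogeneous ideal of `X`. -/
def idealInDegree {ι : Type*} (X : Set (ℙ ℂ (ι → ℂ))) (n : ℕ) :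
    Submodule ℂ (MvPolynomial.homogeneousSubmodule ι ℂ n) where
  carrier := {f | ∀ p ∈ X, MvPolynomial.eval p.rep (f : MvPolynomial ι ℂ) = 0}
  zero_mem' := fun p _ => by simp
  add_mem' := fun {f g} hf hg p hp => by simp [hf p hp, hg p hp]
  smul_mem' := fun c f hf p hp => by simp [MvPolynomial.smul_eval, hf p hp]

/-- The Hilbert function of `X`: the dimension of the degree `n` part of its homogeneous
coordinate ring. -/
def hilbertFunction {ι : Type*} (X : Set (ℙ ℂ (ι → ℂ))) (n : ℕ) : ℕ :=
  Module.finrank ℂ (MvPolynomial.homogeneousSubmodule ι ℂ n ⧸ idealInDegree X n)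

/-- `P` is the Hilbert polynomial of `X`. -/
def IsHilbertPolynomial {ι : Type*} (X : Set (ℙ ℂ (ι → ℂ))) (P : Polynomial ℚ) : Prop :=
  ∀ᶠ n : ℕ in Filter.atTop, (hilbertFunction X n : ℚ) = P.eval (n : ℚ)

/-- `X` has degree `e`: its Hilbert polynomial exists and has leading term `(e / r!) n ^ r`, where
`r`, the degree of the Hilbert polynomial, is the dimension of `X`. -/
def HasDegree {ι : Type*} (X : Set (ℙ ℂ (ι → ℂ))) (e : ℕ) : Prop :=
  ∃ P : Polynomial ℚ, IsHilbertPolynomial X P ∧ (P.natDegree.factorial : ℚ) * P.leadingCoeff = e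

/-! ### Toric varieties -/

/-- The action of a point `t` of the torus on `ℂ^ι`: the coordinate with index `j` is multiplied by
the Laurent monomial `t ^ (a j)`. -/
def torusLin {m : ℕ} {ι : Type*} (a : ι → Fin m → ℤ) (t : Fin m → ℂˣ) :
    (ι → ℂ) →ₗ[ℂ] (ι → ℂ) where
  toFun := fun x j => ((∏ k, t k ^ a j k : ℂˣ) : ℂ) * x j
  map_add' := fun x y => by ext j; simp [mul_add]
  map_smul' := fun c x => by ext j; simp only [Pi.smul_apply, smul_eq_mul, RingHom.id_apply]; ring

theorem torusLin_injective {m : ℕ} {ι : Type*} (a : ι → Fin m → ℤ) (t : Fin m → ℂˣ) :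
    Function.Injective (torusLin a t) := fun x y h => by
  ext j
  exact mul_left_cancel₀ (Units.ne_zero (∏ k, t k ^ a j k)) (congrFun h j)

/-- The diagonal action `t * (x_j)_j = (t ^ (a j) x_j)_j` of the torus on projective space. -/
def torusAct {m : ℕ} {ι : Type*} (a : ι → Fin m → ℤ) (t : Fin m → ℂˣ) :
    ℙ ℂ (ι → ℂ) → ℙ ℂ (ι → ℂ) :=
  Projectivization.map (torusLin a t) (torusLin_injective a t)

/-- The monomial parametrization `t ↦ (t ^ (a j))_j` of the torus orbit of `(1 : ⋯ : 1)`. -/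
def toricParam {m : ℕ} {ι : Type*} [Nonempty ι] (a : ι → Fin m → ℤ) (t : Fin m → ℂˣ) :
    ℙ ℂ (ι → ℂ) :=
  Projectivization.mk ℂ (fun j => ((∏ k, t k ^ a j k : ℂˣ) : ℂ))
    (fun h => Units.ne_zero _ (congrFun h (Classical.arbitrary ι)))

/-- The projective toric variety `X_A`, where the columns of `A` are the vectors `(1, a j)`. -/
def toricVariety {m : ℕ} {ι : Type*} [Nonempty ι] (a : ι → Fin m → ℤ) : Set (ℙ ℂ (ι → ℂ)) :=
  zariskiClosure (Set.range (toricParam a))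

/-- The lattice points in the convex hull of the configuration `a`. -/
def latticePoints {m : ℕ} {ι : Type*} (a : ι → Fin m → ℤ) : Set (Fin m → ℤ) :=
  {u | (fun k => (u k : ℝ)) ∈
    convexHull ℝ (Set.range fun (j : ι) (k : Fin m) => (a j k : ℝ))}

theorem mem_latticePoints {m : ℕ} {ι : Type*} (a : ι → Fin m → ℤ) (j : ι) :
    a j ∈ latticePoints a :=
  subset_convexHull ℝ _ ⟨j, rfl⟩

instance instNonemptyLatticePoints {m : ℕ} {ι : Type*} [Nonempty ι] (a : ι → Fin m → ℤ) : Nonempty (latticePoints a) :=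
  ⟨⟨_, mem_latticePoints a (Classical.arbitrary ι)⟩⟩

/-- The saturated configuration: all lattice points in the convex hull of `a`. -/
def saturation {m : ℕ} {ι : Type*} (a : ι → Fin m → ℤ) : latticePoints a → Fin m → ℤ :=
  fun u => u.1

/-- The inclusion of the columns of the configuration among those of its saturation. -/
def toSaturation {m : ℕ} {ι : Type*} (a : ι → Fin m → ℤ) (j : ι) : latticePoints a :=
  ⟨a j, mem_latticePoints a j⟩

/-! ### Coordinate projections and normalization -/

/-- The linear projection of projective space which keeps the coordinates `σ k`, at a point off its
center, the linear space where all those coordinates vanish. -/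
def coordProj {ι κ : Type*} (σ : κ → ι) (p : ℙ ℂ (ι → ℂ)) (h : (fun k => p.rep (σ k)) ≠ 0) :
    ℙ ℂ (κ → ℂ) :=
  Projectivization.mk ℂ (fun k => p.rep (σ k)) h

/-- The coordinate projection along `σ` is defined on all of `X` and has image `Y`. -/
structure ProjectsOnto {ι κ : Type*} (σ : κ → ι) (X : Set (ℙ ℂ (ι → ℂ)))
    (Y : Set (ℙ ℂ (κ → ℂ))) : Prop where
  injective : Function.Injective σ
  off_center : ∀ p ∈ X, (fun k => p.rep (σ k)) ≠ 0
  image_eq : {q | ∃ p ∈ X, ∃ h, coordProj σ p h = q} = Y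

/-- The affine chart `X ∩ {x_i ≠ 0}`, as a subset of the affine space `{x_i = 1}` in `ℂ^ι`. -/
def chart {ι : Type*} (X : Set (ℙ ℂ (ι → ℂ))) (i : ι) : Set (ι → ℂ) :=
  {v | v i = 1 ∧ ∃ h : v ≠ 0, Projectivization.mk ℂ v h ∈ X}

/-- The coordinate ring of an affine algebraic set. -/
abbrev coordRing {ι : Type*} (V : Set (ι → ℂ)) : Type _ :=
  MvPolynomial ι ℂ ⧸ MvPolynomial.vanishingIdeal ℂ V

/-- The homomorphism of coordinate rings given by the map `v ↦ v ∘ σ` from `V` to `W`. -/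
def comorphism {ι κ : Type*} (σ : κ → ι) (V : Set (ι → ℂ)) (W : Set (κ → ℂ))
    (h : ∀ v ∈ V, (fun k => v (σ k)) ∈ W) : coordRing W →ₐ[ℂ] coordRing V :=
  Ideal.quotientMapₐ _ (MvPolynomial.rename σ) fun f hf => by
    rw [Ideal.mem_comap, MvPolynomial.mem_vanishingIdeal_iff]
    intro v hv
    rw [MvPolynomial.aeval_rename]
    exact hf _ (h v hv)

theorem ProjectsOnto.mapsTo_chart {ι κ : Type*} {σ : κ → ι} {X : Set (ℙ ℂ (ι → ℂ))}
    {Y : Set (ℙ ℂ (κ → ℂ))} (H : ProjectsOnto σ X Y) (j : κ) :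
    ∀ v ∈ chart X (σ j), (fun k => v (σ k)) ∈ chart Y j := by
  rintro v ⟨hv1, hv0, hvX⟩
  have hne : (fun k => v (σ k)) ≠ 0 := fun h => by
    have := congrFun h j
    simp [hv1] at this
  refine ⟨hv1, hne, ?_⟩
  rw [← H.image_eq]
  refine ⟨_, hvX, H.off_center _ hvX, ?_⟩
  obtain ⟨c, hc⟩ := Projectivization.exists_smul_eq_mk_rep ℂ v hv0
  refine (Projectivization.mk_eq_mk_iff ℂ _ _ _ _).2 ⟨c, ?_⟩
  rw [← hc]
  rfl

/-- A homomorphism of coordinate rings `φ : A → B` makes `B` the normalization of the domain `A`: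
`B` is an integrally closed domain, finite over `A`, and with the same field of fractions. -/
structure IsAffineNormalization {A B : Type*} [CommRing A] [CommRing B] [Algebra ℂ A] [Algebra ℂ B]
    (φ : A →ₐ[ℂ] B) : Prop where
  isDomain_base : IsDomain A
  isDomain : IsDomain B
  normal : IsIntegrallyClosed B
  finite : φ.Finite
  injective : Function.Injective φ
  birational : ∀ b : B, ∃ a s : A, s ≠ 0 ∧ φ s * b = φ a

/-- The coordinate projection from `X` onto `Y` is the normalization of `Y`: `X` is normal and the
projection is finite and birational. This is expressed over the affine open cover of `Y` by the sets
`{y_j ≠ 0}`, whose preimages `{x_(σ j) ≠ 0}` form an affine open cover of `X`. -/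
def ProjectsOnto.IsNormalization {ι κ : Type*} {σ : κ → ι} {X : Set (ℙ ℂ (ι → ℂ))}
    {Y : Set (ℙ ℂ (κ → ℂ))} (H : ProjectsOnto σ X Y) : Prop :=
  ∀ j : κ, IsAffineNormalization
    (comorphism σ (chart X (σ j)) (chart Y j) (H.mapsTo_chart j))

/-- The coordinate projection along `σ` is toric on `X`: it commutes with the action of the torus on
the source, by the characters `b`, and on the target, by the characters `a`. -/
def ProjectsOnto.IsToric {ι κ : Type*} {σ : κ → ι} {X : Set (ℙ ℂ (ι → ℂ))}
    {Y : Set (ℙ ℂ (κ → ℂ))} (_H : ProjectsOnto σ X Y) {m : ℕ} (b : ι → Fin m → ℤ)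
    (a : κ → Fin m → ℤ) : Prop :=
  ∀ t : Fin m → ℂˣ, ∀ p ∈ X, torusAct b t p ∈ X ∧
    ∀ (h : (fun k => p.rep (σ k)) ≠ 0) (h' : (fun k => (torusAct b t p).rep (σ k)) ≠ 0),
      coordProj σ (torusAct b t p) h' = torusAct a t (coordProj σ p h)

/-! ### Interpolants of toric curves -/

/-- The configuration of the `k`-th toric interpolant of the toric curve
`t ↦ (t ^ ℓ 0 : ⋯ : t ^ ℓ d)`: the columns of its matrix are
`(1, ℓ j, (ℓ j).choose 2, …, (ℓ j).choose k)`. -/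
def curveInterpolant {d : ℕ} (ℓ : Fin (d + 1) → ℕ) (k : ℕ) : Fin (d + 1) → Fin k → ℤ :=
  fun j i => ((ℓ j).choose ((i : ℕ) + 1) : ℤ)

/-- The configuration of the second toric interpolant of the rational normal curve of degree `d`. -/
def secondInterpolant (d : ℕ) : Fin (d + 1) → Fin 2 → ℤ :=
  curveInterpolant (fun j : Fin (d + 1) => (j : ℕ)) 2

end ToricInterpolation

end

open ToricInterpolation

open scoped LinearAlgebra.Projectivization


/-! ### Points of projective toric varieties -/

/-! The points `(j, j.choose 2)` lie on a convex parabola, so each is a vertex of their hull `Q`.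
The hull is bounded below by the chords between consecutive points and above by the line `2y = (d -
1)x`.

Degree. In degree `n`, the homogeneous coordinate ring of a toric variety has one basis monomial for
each distinct sum of `n` points of the configuration (`hilbertFunction_toricVariety`). The number of
such sums is eventually a polynomial in `n` by an initial-ideal argument
(`eventuallyPolynomial_card_sumset`). For its leading term, the sums are counted column by column.
In each column they start at the lower boundary of `n • Q` rounded to the lattice (`lowerEnd`) and
have no gap until within a bounded distance of the top (`isSum_of_lowerEnd_le`). So the count is
`area(Q) n ^ 2 + O(n)` with `area(Q) = (d + 1)d(d - 1)/12`, and the degree is `2! * area(Q) = (d +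
1).choose 3`.

Normalization. The chart at a vertex `a j` has as coordinate ring the algebra of the semigroup
generated by the differences from `a j`. Two independent forms that are nonnegative on the vertex
cone embed it in `ℂ[s₀, s₁]`. For the saturated configuration this semigroup contains every lattice
point of the cone (`mem_closure_vertex_cone`). Discarding all other monomials is then a linear
retraction over the semigroup algebra, which makes the algebra integrally closed. Finiteness holds
because a positive multiple of each lattice point of `Q` is a nonnegative integer combination of the
`a k` (`exists_convex_combination`). Birationality holds because `a 0`, `a 1`, `a 2` form an affine
basis of the lattice (`exists_group_combination`). Surjectivity on points is lying over.

Counting lattice points amounts to summing the column heights of `Q`, where the parity of `d`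
decides the rounding at the upper edge. -/

theorem MvPolynomial.IsHomogeneous.eval_smul_vec {ι : Type*} {f : MvPolynomial ι ℂ} {n : ℕ}
    (hf : f.IsHomogeneous n) (c : ℂ) (v : ι → ℂ) :
    MvPolynomial.eval (c • v) f = c ^ n * MvPolynomial.eval v f := by
  simp only [MvPolynomial.eval_eq, Finset.mul_sum]
  refine Finset.sum_congr rfl fun d hd => ?_
  have h : ∑ i ∈ d.support, d i = n := by
    have := hf (MvPolynomial.mem_support_iff.1 hd)
    rwa [Finsupp.weight_apply, Finsupp.sum, Finset.sum_congr rfl fun i _ => by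
      rw [Pi.one_apply, smul_eq_mul, mul_one]] at this
  simp only [Pi.smul_apply, smul_eq_mul, mul_pow, Finset.prod_mul_distrib]
  rw [Finset.prod_pow_eq_pow_sum, h]
  ring

theorem Projectivization.eval_rep_eq_zero_iff {ι : Type*} {f : MvPolynomial ι ℂ} {n : ℕ}
    (hf : f.IsHomogeneous n) (v : ι → ℂ) (hv : v ≠ 0) :
    MvPolynomial.eval (Projectivization.mk ℂ v hv).rep f = 0 ↔ MvPolynomial.eval v f = 0 := by
  obtain ⟨c, hc⟩ := Projectivization.exists_smul_eq_mk_rep ℂ v hv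
  rw [← hc, Units.smul_def, hf.eval_smul_vec]
  simp

namespace ToricInterpolation

/-- The vector of Laurent monomials `t ^ (b j)`. -/
def monomialVec {m : ℕ} {ι : Type*} (b : ι → Fin m → ℤ) (t : Fin m → ℂˣ) : ι → ℂ :=
  fun j => ((∏ k, t k ^ b j k : ℂˣ) : ℂ)

theorem monomialVec_ne_zero {m : ℕ} {ι : Type*} [Nonempty ι] (b : ι → Fin m → ℤ)
    (t : Fin m → ℂˣ) : monomialVec b t ≠ 0 :=
  fun h => Units.ne_zero _ (congrFun h (Classical.arbitrary ι))

theorem mk_mem_toricVariety_iff {m : ℕ} {ι : Type*} [Nonempty ι] (b : ι → Fin m → ℤ)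
    (v : ι → ℂ) (hv : v ≠ 0) :
    Projectivization.mk ℂ v hv ∈ toricVariety b ↔
      ∀ (n : ℕ) (f : MvPolynomial ι ℂ), f.IsHomogeneous n →
        (∀ t, MvPolynomial.eval (monomialVec b t) f = 0) → MvPolynomial.eval v f = 0 := by
  have key : ∀ (n : ℕ) (f : MvPolynomial ι ℂ), f.IsHomogeneous n →
      ((∀ q ∈ Set.range (toricParam b), MvPolynomial.eval q.rep f = 0) ↔
        ∀ t, MvPolynomial.eval (monomialVec b t) f = 0) := fun n f hf => by
    rw [Set.forall_mem_range]
    exact forall_congr' fun t =>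
      Projectivization.eval_rep_eq_zero_iff hf _ (monomialVec_ne_zero b t)
  refine forall₃_congr fun n f hf => ?_
  rw [key n f hf, Projectivization.eval_rep_eq_zero_iff hf]

theorem mk_monomialVec_mem {m : ℕ} {ι : Type*} [Nonempty ι] (b : ι → Fin m → ℤ)
    (t : Fin m → ℂˣ) :
    Projectivization.mk ℂ _ (monomialVec_ne_zero b t) ∈ toricVariety b :=
  (mk_mem_toricVariety_iff b _ _).2 fun _ _ _ h => h t

theorem mem_toricVariety_iff {m : ℕ} {ι : Type*} [Nonempty ι] (b : ι → Fin m → ℤ)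
    (p : ℙ ℂ (ι → ℂ)) :
    p ∈ toricVariety b ↔
      ∀ (n : ℕ) (f : MvPolynomial ι ℂ), f.IsHomogeneous n →
        (∀ t, MvPolynomial.eval (monomialVec b t) f = 0) → MvPolynomial.eval p.rep f = 0 := by
  rw [← mk_mem_toricVariety_iff b p.rep p.rep_nonzero, Projectivization.mk_rep]

/-! ### Monomial maps -/

/-- The homomorphism of polynomial rings sending the variable `X k` to the monomial with
exponent `e k`. -/
noncomputable def monomialMap {ι σ : Type*} (e : ι → σ →₀ ℕ) :
    MvPolynomial ι ℂ →ₐ[ℂ] MvPolynomial σ ℂ :=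
  MvPolynomial.aeval fun k => MvPolynomial.monomial (e k) 1

theorem monomialMap_monomial {ι σ : Type*} (e : ι → σ →₀ ℕ) (c : ι →₀ ℕ) (r : ℂ) :
    monomialMap e (MvPolynomial.monomial c r) =
      MvPolynomial.monomial (c.sum fun k n => n • e k) r := by
  rw [monomialMap, MvPolynomial.aeval_monomial, Finsupp.prod, Finsupp.sum,
    ← mul_one r, ← MvPolynomial.C_mul_monomial, MvPolynomial.monomial_sum_one, mul_one]
  simp [MvPolynomial.monomial_pow, MvPolynomial.algebraMap_eq]

theorem eval_monomialMap {ι σ : Type*} (e : ι → σ →₀ ℕ) (s : σ → ℂ) (f : MvPolynomial ι ℂ) :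
    MvPolynomial.eval s (monomialMap e f) =
      MvPolynomial.eval (fun k => MvPolynomial.eval s (MvPolynomial.monomial (e k) 1)) f := by
  induction f using MvPolynomial.induction_on with
  | C a => simp [monomialMap]
  | add p q hp hq => simp [hp, hq]
  | mul_X p k hp => rw [map_mul, map_mul, map_mul, hp, monomialMap, MvPolynomial.aeval_X, MvPolynomial.eval_X]

/-- The torus is Zariski dense in affine space. -/
theorem eq_zero_of_eval_units_eq_zero {σ : Type*} [Finite σ] {g : MvPolynomial σ ℂ}
    (h : ∀ s : σ → ℂˣ, MvPolynomial.eval (fun i => (s i : ℂ)) g = 0) : g = 0 := by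
  refine MvPolynomial.funext_set (fun _ => {0}ᶜ)
    (fun _ => (Set.finite_singleton (0 : ℂ)).infinite_compl) fun x hx => ?_
  rw [map_zero]
  exact h fun i => Units.mk0 (x i) (hx i (Set.mem_univ i))

theorem monomialMap_eq_zero_iff {ι σ : Type*} [Finite σ] (e : ι → σ →₀ ℕ)
    (f : MvPolynomial ι ℂ) :
    monomialMap e f = 0 ↔ ∀ s : σ → ℂˣ, MvPolynomial.eval
      (fun k => MvPolynomial.eval (fun i => (s i : ℂ)) (MvPolynomial.monomial (e k) 1)) f = 0 := by
  simp only [← eval_monomialMap]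
  exact ⟨fun h s => by rw [h, map_zero], eq_zero_of_eval_units_eq_zero⟩

theorem exists_zpow_eq {D : ℤ} (hD : D ≠ 0) (t : ℂˣ) : ∃ r : ℂˣ, r ^ D = t := by
  obtain ⟨z, hz⟩ := IsAlgClosed.exists_pow_nat_eq (t : ℂ) (Int.natAbs_pos.2 hD)
  have hz0 : z ≠ 0 := by
    rintro rfl
    rw [zero_pow (Int.natAbs_ne_zero.2 hD)] at hz
    exact t.ne_zero hz.symm
  have hr : (Units.mk0 z hz0) ^ D.natAbs = t := Units.ext (by simpa using hz)
  rcases Int.natAbs_eq D with h | h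
  · exact ⟨Units.mk0 z hz0, by rw [h, zpow_natCast, hr]⟩
  · exact ⟨(Units.mk0 z hz0)⁻¹, by rw [h, zpow_neg, inv_zpow, inv_inv, zpow_natCast, hr]⟩

theorem exists_prod_zpow_mulVec (A : Matrix (Fin 2) (Fin 2) ℤ) (s : Fin 2 → ℂˣ) :
    ∃ t : Fin 2 → ℂˣ, ∀ u : Fin 2 → ℤ, ∏ k, t k ^ u k = ∏ k, s k ^ A.mulVec u k := by
  refine ⟨fun j => ∏ i, s i ^ A i j, fun u => ?_⟩
  simp only [Fin.prod_univ_two, Matrix.mulVec, dotProduct, Fin.sum_univ_two, zpow_add, mul_zpow,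
    zpow_mul]
  exact mul_mul_mul_comm _ _ _ _

/-- The torus homomorphism dual to `A` is surjective even when `A` is not unimodular: take roots of
`t` of order `det A` and raise them to the entries of the adjugate. -/
theorem exists_prod_zpow_eq_mulVec {A : Matrix (Fin 2) (Fin 2) ℤ} (hA : A.det ≠ 0)
    (t : Fin 2 → ℂˣ) :
    ∃ s : Fin 2 → ℂˣ, ∀ u : Fin 2 → ℤ, ∏ k, t k ^ u k = ∏ k, s k ^ A.mulVec u k := by
  choose r hr using fun i => exists_zpow_eq hA (t i)
  refine ⟨fun i => ∏ j, r j ^ A.adjugate j i, fun u => ?_⟩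
  simp only [← hr, Fin.prod_univ_two, Matrix.mulVec, dotProduct, Fin.sum_univ_two, mul_zpow,
    ← zpow_mul, Matrix.adjugate_fin_two, Matrix.det_fin_two, Matrix.of_apply, Matrix.cons_val_zero,
    Matrix.cons_val_one, Matrix.cons_val', Matrix.cons_val_fin_one]
  rw [mul_mul_mul_comm, ← zpow_add, ← zpow_add]
  congr 2 <;> ring

theorem eval_units_monomial {σ : Type*} [Fintype σ] (s : σ → ℂˣ) (e : σ →₀ ℕ) (u : σ → ℤ)
    (h : ∀ i, (e i : ℤ) = u i) :
    MvPolynomial.eval (fun i => (s i : ℂ)) (MvPolynomial.monomial e 1) =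
      ((∏ i, s i ^ u i : ℂˣ) : ℂ) := by
  rw [MvPolynomial.eval_monomial, one_mul, Finsupp.prod_fintype _ _ fun _ => pow_zero _]
  simp [← h]

/-! ### The coordinate rings of affine charts of toric varieties -/

theorem monomialVec_mem_chart {m : ℕ} {ι : Type*} [Nonempty ι] (b : ι → Fin m → ℤ) (i : ι)
    (t : Fin m → ℂˣ) :
    monomialVec (fun k => b k - b i) t ∈ chart (toricVariety b) i := by
  refine ⟨by simp [monomialVec], monomialVec_ne_zero _ t, ?_⟩
  convert mk_monomialVec_mem b t using 1
  rw [Projectivization.mk_eq_mk_iff]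
  refine ⟨∏ k, t k ^ (-b i k), ?_⟩
  ext k
  simp only [monomialVec, Pi.smul_apply, Units.smul_def, smul_eq_mul, ← Units.val_mul,
    ← Finset.prod_mul_distrib, ← zpow_add, Pi.sub_apply]
  congr 3 with l
  ring_nf

theorem mem_vanishingIdeal_chart_of_forall {m : ℕ} {ι : Type*} [Nonempty ι]
    {b : ι → Fin m → ℤ} {i : ι} {f : MvPolynomial ι ℂ}
    (hf : ∀ t, MvPolynomial.eval (monomialVec (fun k => b k - b i) t) f = 0) :
    f ∈ MvPolynomial.vanishingIdeal ℂ (chart (toricVariety b) i) := by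
  rw [MvPolynomial.mem_vanishingIdeal_iff]
  rintro v ⟨hvi, hv0, hv⟩
  set N := f.totalDegree
  -- `F` is the homogenization of `f` by `X i`, which agrees with `f` where the coordinate `i` is
  -- `1`.
  set F : MvPolynomial ι ℂ := ∑ n ∈ Finset.range (N + 1),
    MvPolynomial.X i ^ (N - n) * MvPolynomial.homogeneousComponent n f with hF
  have hom : F.IsHomogeneous N := MvPolynomial.IsHomogeneous.sum _ _ _ fun n hn => by
    have := (MvPolynomial.isHomogeneous_X_pow (R := ℂ) i (N - n)).mul
      (MvPolynomial.homogeneousComponent_isHomogeneous n f)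
    rwa [Nat.sub_add_cancel (Finset.mem_range_succ_iff.1 hn)] at this
  have hone : ∀ w : ι → ℂ, w i = 1 → MvPolynomial.eval w F = MvPolynomial.eval w f := by
    intro w hw
    conv_rhs => rw [← MvPolynomial.sum_homogeneousComponent f]
    simp [hF, hw, N]
  rw [MvPolynomial.aeval_eq_eval, ← hone v hvi]
  refine (mk_mem_toricVariety_iff b v hv0).1 hv N F hom fun t => ?_
  have h : monomialVec b t =
      ((∏ k, t k ^ b i k : ℂˣ) : ℂ) • monomialVec (fun k => b k - b i) t := by
    ext k
    simp only [monomialVec, Pi.smul_apply, smul_eq_mul, ← Units.val_mul,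
      ← Finset.prod_mul_distrib, ← zpow_add, Pi.sub_apply, add_sub_cancel]
  rw [h, hom.eval_smul_vec, hone _ (by simp [monomialVec]), hf, mul_zero]

/-- This identifies the coordinate ring of a chart with an algebra of monomials in two variables.
`A` need not be invertible over `ℤ`: a nonzero determinant lets every torus point be reached through
`A`. -/
theorem mem_vanishingIdeal_chart_iff {ι : Type*} [Nonempty ι] {b : ι → Fin 2 → ℤ} {i : ι}
    {A : Matrix (Fin 2) (Fin 2) ℤ} (hA : A.det ≠ 0) {e : ι → Fin 2 →₀ ℕ}
    (he : ∀ k r, (e k r : ℤ) = A.mulVec (b k - b i) r) (f : MvPolynomial ι ℂ) :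
    f ∈ MvPolynomial.vanishingIdeal ℂ (chart (toricVariety b) i) ↔ monomialMap e f = 0 := by
  rw [monomialMap_eq_zero_iff]
  constructor
  · intro hf s
    obtain ⟨t, ht⟩ := exists_prod_zpow_mulVec A s
    have := (MvPolynomial.mem_vanishingIdeal_iff.1 hf) _ (monomialVec_mem_chart b i t)
    rw [MvPolynomial.aeval_eq_eval] at this
    rwa [funext fun k => eval_units_monomial s (e k) _ (he k), funext fun k => congrArg _ (ht _).symm]
  · intro hf
    refine mem_vanishingIdeal_chart_of_forall fun t => ?_
    obtain ⟨s, hs⟩ := exists_prod_zpow_eq_mulVec hA t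
    have := hf s
    rwa [funext fun k => eval_units_monomial s (e k) _ (he k), funext fun k => congrArg _ (hs _).symm]
      at this

end ToricInterpolation

/-! ### Retracts of integrally closed domains -/

/-- An integral fraction `p / q` of `B` equals some `c` in `C`. Applying `ρ` to `f q * c = f p`
gives `f q * ρ c = f p`, so the preimage of `ρ c` is the quotient in `B`. -/
theorem IsIntegrallyClosed.of_retraction {B C : Type*} [CommRing B] [IsDomain B] [CommRing C]
    [IsDomain C] [IsIntegrallyClosed C] (f : B →+* C) (hf : Function.Injective f) (ρ : C → C)
    (hmul : ∀ b c, ρ (f b * c) = f b * ρ c) (hone : ρ 1 = 1) (hrange : ∀ c, ∃ b, f b = ρ c) :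
    IsIntegrallyClosed B := by
  rw [isIntegrallyClosed_iff (FractionRing B)]
  intro x hx
  obtain ⟨p, q, hq, rfl⟩ := IsFractionRing.div_surjective (A := B) x
  have hq0 : q ≠ 0 := nonZeroDivisors.ne_zero hq
  let g : FractionRing B →+* FractionRing C := IsFractionRing.map hf
  have hg : ∀ b, g (algebraMap B _ b) = algebraMap C _ (f b) := fun b =>
    IsLocalization.map_eq _ b
  have hint : IsIntegral C (g (algebraMap B _ p / algebraMap B _ q)) :=
    hx.map_of_comp_eq f g (RingHom.ext fun b => (hg b).symm)
  obtain ⟨c, hc⟩ := IsIntegrallyClosed.algebraMap_eq_of_integral hint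
  have hfq : f q ≠ 0 := fun h => hq0 (hf (by rw [h, map_zero]))
  have hcq : f q * c = f p := by
    apply IsFractionRing.injective C (FractionRing C)
    rw [map_mul, hc, map_div₀, hg, hg, mul_div_cancel₀]
    exact fun h => hfq (IsFractionRing.injective C (FractionRing C) (by rw [h, map_zero]))
  obtain ⟨b, hb⟩ := hrange c
  have hqb : q * b = p := by
    apply hf
    rw [map_mul, hb, ← hmul, hcq, ← mul_one (f p), hmul, hone, mul_one]
  refine ⟨b, ?_⟩
  rw [eq_div_iff, ← hqb, map_mul, mul_comm]
  exact fun h => hq0 (IsFractionRing.injective B (FractionRing B) (by rw [h, map_zero]))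

namespace ToricInterpolation

/-! ### Algebras spanned by monomials, and when they are integrally closed -/

section MonomialAlgebra

variable {ι σ : Type*} (e : ι → σ →₀ ℕ)

theorem exists_monomialMap_eq_monomial {m : σ →₀ ℕ}
    (hm : m ∈ AddSubmonoid.closure (Set.range e)) (r : ℂ) :
    ∃ f, monomialMap e f = MvPolynomial.monomial m r := by
  induction hm using AddSubmonoid.closure_induction generalizing r with
  | mem _ h =>
    obtain ⟨k, rfl⟩ := h
    exact ⟨MvPolynomial.monomial (Finsupp.single k 1) r, by simp [monomialMap_monomial]⟩
  | zero => exact ⟨MvPolynomial.C r, by simp [monomialMap, MvPolynomial.algebraMap_eq]⟩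
  | add m n _ _ hm hn =>
    obtain ⟨f, hf⟩ := hm r
    obtain ⟨g, hg⟩ := hn 1
    exact ⟨f * g, by rw [map_mul, hf, hg, MvPolynomial.monomial_mul, mul_one]⟩

theorem finsuppSum_mem_closure (c : ι →₀ ℕ) :
    (c.sum fun k n => n • e k) ∈ AddSubmonoid.closure (Set.range e) :=
  sum_mem fun k _ => AddSubmonoid.nsmul_mem _ (AddSubmonoid.subset_closure (Set.mem_range_self k)) _

open Classical in
/-- The projection of a polynomial to its terms with exponents in `S`. -/
noncomputable def exponentProj (S : AddSubmonoid (σ →₀ ℕ)) :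
    MvPolynomial σ ℂ →ₗ[ℂ] MvPolynomial σ ℂ :=
  (MvPolynomial.basisMonomials σ ℂ).constr ℂ
    fun m => if m ∈ S then MvPolynomial.monomial m 1 else 0

open Classical in
theorem exponentProj_monomial_of_mem {S : AddSubmonoid (σ →₀ ℕ)} {m : σ →₀ ℕ} (h : m ∈ S)
    (r : ℂ) : exponentProj S (MvPolynomial.monomial m r) = MvPolynomial.monomial m r := by
  have : exponentProj S (MvPolynomial.monomial m 1) = MvPolynomial.monomial m 1 := by
    have := (MvPolynomial.basisMonomials σ ℂ).constr_basis ℂ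
      (fun m => if m ∈ S then (MvPolynomial.monomial m 1 : MvPolynomial σ ℂ) else 0) m
    rw [MvPolynomial.coe_basisMonomials] at this
    exact this.trans (if_pos h)
  rw [← mul_one r, ← smul_eq_mul, ← MvPolynomial.smul_monomial, map_smul, this]

open Classical in
theorem exponentProj_monomial_of_notMem {S : AddSubmonoid (σ →₀ ℕ)} {m : σ →₀ ℕ} (h : m ∉ S)
    (r : ℂ) : exponentProj S (MvPolynomial.monomial m r) = 0 := by
  have : exponentProj S (MvPolynomial.monomial m 1) = 0 := by
    have := (MvPolynomial.basisMonomials σ ℂ).constr_basis ℂ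
      (fun m => if m ∈ S then (MvPolynomial.monomial m 1 : MvPolynomial σ ℂ) else 0) m
    rw [MvPolynomial.coe_basisMonomials] at this
    exact this.trans (if_neg h)
  rw [← mul_one r, ← smul_eq_mul, ← MvPolynomial.smul_monomial, map_smul, this, smul_zero]

/-- Closure of `S` under differences means that a translate by an element of `S` of an exponent
outside `S` stays outside `S`. So the discarded monomials are stable under multiplication by those
of `S`. -/
theorem exponentProj_mul {S : AddSubmonoid (σ →₀ ℕ)}
    (hS : ∀ m n, m ∈ S → m + n ∈ S → n ∈ S) {m : σ →₀ ℕ} (hm : m ∈ S) (r : ℂ)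
    (g : MvPolynomial σ ℂ) :
    exponentProj S (MvPolynomial.monomial m r * g) =
      MvPolynomial.monomial m r * exponentProj S g := by
  induction g using MvPolynomial.induction_on' with
  | add p q hp hq => rw [mul_add, map_add, hp, hq, map_add, mul_add]
  | monomial n s =>
    rw [MvPolynomial.monomial_mul]
    by_cases hn : n ∈ S
    · rw [exponentProj_monomial_of_mem hn, exponentProj_monomial_of_mem (add_mem hm hn),
        MvPolynomial.monomial_mul]
    · rw [exponentProj_monomial_of_notMem hn,
        exponentProj_monomial_of_notMem fun h => hn (hS m n hm h), mul_zero]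

theorem isIntegrallyClosed_of_injective_of_range_eq_monomialMap {B : Type*} [CommRing B]
    [IsDomain B] (f : B →+* MvPolynomial σ ℂ) (hf : Function.Injective f)
    (hrange : f.range = (monomialMap e).toRingHom.range)
    (hS : ∀ m n, m ∈ AddSubmonoid.closure (Set.range e) →
      m + n ∈ AddSubmonoid.closure (Set.range e) → n ∈ AddSubmonoid.closure (Set.range e)) :
    IsIntegrallyClosed B := by
  refine IsIntegrallyClosed.of_retraction f hf
    (exponentProj (AddSubmonoid.closure (Set.range e))) (fun b c => ?_)
    (exponentProj_monomial_of_mem (zero_mem _) 1) (fun c => ?_)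
  · obtain ⟨p, hp⟩ : f b ∈ (monomialMap e).toRingHom.range := hrange ▸ ⟨b, rfl⟩
    rw [← hp]
    clear hp
    induction p using MvPolynomial.induction_on' with
    | add p q hp hq => rw [map_add, add_mul, map_add, hp, hq, add_mul]
    | monomial m r =>
      change exponentProj _ (monomialMap e _ * c) = monomialMap e _ * _
      rw [monomialMap_monomial]
      exact exponentProj_mul hS (finsuppSum_mem_closure e m) r c
  · change exponentProj _ c ∈ f.range
    rw [hrange]
    induction c using MvPolynomial.induction_on' with
    | add p q hp hq => rw [map_add]; exact add_mem hp hq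
    | monomial m r =>
      by_cases hm : m ∈ AddSubmonoid.closure (Set.range e)
      · rw [exponentProj_monomial_of_mem hm]
        exact exists_monomialMap_eq_monomial e hm r
      · rw [exponentProj_monomial_of_notMem hm]
        exact zero_mem _

end MonomialAlgebra

/-- Nonnegative integer vectors with given nonnegative coordinates. -/
noncomputable def toExponent {σ : Type*} [Finite σ] (u : σ → ℤ) : σ →₀ ℕ :=
  Finsupp.equivFunOnFinite.symm fun r => (u r).toNat

theorem toExponent_apply {σ : Type*} [Finite σ] {u : σ → ℤ} (hu : ∀ r, 0 ≤ u r) (r : σ) :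
    (toExponent u r : ℤ) = u r :=
  Int.toNat_of_nonneg (hu r)

/-- When the differences generate all lattice points of the cone, the exponents are exactly the
points of the lattice `A ℤ²` in the orthant. Such a semigroup is closed under those differences that
are nonnegative. -/
theorem mem_closure_exponents_iff {ι : Type*} {b : ι → Fin 2 → ℤ} {i : ι}
    {A : Matrix (Fin 2) (Fin 2) ℤ} {e : ι → Fin 2 →₀ ℕ}
    (he : ∀ k r, (e k r : ℤ) = A.mulVec (b k - b i) r)
    (hcone : ∀ u, (∀ r, 0 ≤ A.mulVec u r) →
      u ∈ AddSubmonoid.closure (Set.range fun k => b k - b i)) (m : Fin 2 →₀ ℕ) :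
    m ∈ AddSubmonoid.closure (Set.range e) ↔ ∃ u, ∀ r, (m r : ℤ) = A.mulVec u r := by
  constructor
  · intro hm
    induction hm using AddSubmonoid.closure_induction with
    | mem _ h =>
      obtain ⟨k, rfl⟩ := h
      exact ⟨_, he k⟩
    | zero => exact ⟨0, by simp⟩
    | add m n _ _ hm hn =>
      obtain ⟨u, hu⟩ := hm
      obtain ⟨v, hv⟩ := hn
      exact ⟨u + v, fun r => by simp [Matrix.mulVec_add, hu, hv]⟩
  · rintro ⟨u, hu⟩
    have key : ∀ u ∈ AddSubmonoid.closure (Set.range fun k => b k - b i),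
        ∃ n ∈ AddSubmonoid.closure (Set.range e), ∀ r, (n r : ℤ) = A.mulVec u r := by
      intro u hu
      induction hu using AddSubmonoid.closure_induction with
      | mem _ h =>
        obtain ⟨k, rfl⟩ := h
        exact ⟨e k, AddSubmonoid.subset_closure ⟨k, rfl⟩, he k⟩
      | zero => exact ⟨0, zero_mem _, by simp⟩
      | add u v _ _ hu hv =>
        obtain ⟨m, hm, hu⟩ := hu
        obtain ⟨n, hn, hv⟩ := hv
        exact ⟨m + n, add_mem hm hn, fun r => by simp [Matrix.mulVec_add, hu, hv]⟩
    obtain ⟨n, hn, hnu⟩ := key u (hcone u fun r => hu r ▸ Int.natCast_nonneg _)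
    have : m = n := Finsupp.ext fun r => by exact_mod_cast (hu r).trans (hnu r).symm
    exact this ▸ hn

/-! ### Charts of toric surfaces as monomial algebras -/

section Chart

variable {ι : Type*} [Nonempty ι] {b : ι → Fin 2 → ℤ} {i : ι} {A : Matrix (Fin 2) (Fin 2) ℤ}
  {e : ι → Fin 2 →₀ ℕ}

/-- The embedding of the coordinate ring of an affine chart of a toric surface in a polynomial ring
given by two independent linear forms. -/
noncomputable def chartEmbedding (hA : A.det ≠ 0)
    (he : ∀ k r, (e k r : ℤ) = A.mulVec (b k - b i) r) :
    coordRing (chart (toricVariety b) i) →ₐ[ℂ] MvPolynomial (Fin 2) ℂ :=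
  Ideal.Quotient.liftₐ _ (monomialMap e) fun f hf => (mem_vanishingIdeal_chart_iff hA he f).1 hf

theorem chartEmbedding_mk (hA : A.det ≠ 0) (he : ∀ k r, (e k r : ℤ) = A.mulVec (b k - b i) r)
    (f : MvPolynomial ι ℂ) :
    chartEmbedding hA he (Ideal.Quotient.mk _ f) = monomialMap e f :=
  rfl

theorem chartEmbedding_injective (hA : A.det ≠ 0)
    (he : ∀ k r, (e k r : ℤ) = A.mulVec (b k - b i) r) :
    Function.Injective (chartEmbedding hA he) := by
  rw [injective_iff_map_eq_zero]
  intro x hx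
  obtain ⟨f, rfl⟩ := Ideal.Quotient.mk_surjective x
  rw [chartEmbedding_mk, ← mem_vanishingIdeal_chart_iff hA he] at hx
  exact Ideal.Quotient.eq_zero_iff_mem.2 hx

theorem isIntegrallyClosed_coordRing_chart (hA : A.det ≠ 0)
    (hpos : ∀ k r, 0 ≤ A.mulVec (b k - b i) r)
    (hcone : ∀ u, (∀ r, 0 ≤ A.mulVec u r) →
      u ∈ AddSubmonoid.closure (Set.range fun k => b k - b i)) :
    IsIntegrallyClosed (coordRing (chart (toricVariety b) i)) := by
  have he : ∀ k r, (toExponent (A.mulVec (b k - b i)) r : ℤ) = A.mulVec (b k - b i) r :=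
    fun k => toExponent_apply (hpos k)
  have hinj := chartEmbedding_injective hA he
  have : IsDomain (coordRing (chart (toricVariety b) i)) := hinj.isDomain _
  refine isIntegrallyClosed_of_injective_of_range_eq_monomialMap
    (fun k => toExponent (A.mulVec (b k - b i))) (chartEmbedding hA he).toRingHom hinj ?_ fun m n hm hmn => ?_
  · ext g
    constructor
    · rintro ⟨x, rfl⟩
      obtain ⟨f, rfl⟩ := Ideal.Quotient.mk_surjective x
      exact ⟨f, rfl⟩
    · rintro ⟨f, rfl⟩
      exact ⟨Ideal.Quotient.mk _ f, rfl⟩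
  · rw [mem_closure_exponents_iff he hcone] at hm hmn ⊢
    obtain ⟨u, hu⟩ := hm
    obtain ⟨v, hv⟩ := hmn
    refine ⟨v - u, fun r => ?_⟩
    rw [Matrix.mulVec_sub, Pi.sub_apply, ← hu, ← hv]
    simp

end Chart

/-! ### Normalization of toric surfaces -/

section Normalization

variable {ι κ : Type*} [Nonempty ι] [Nonempty κ] {b : ι → Fin 2 → ℤ} {a : κ → Fin 2 → ℤ}
  {σ : κ → ι} {j : κ} {A : Matrix (Fin 2) (Fin 2) ℤ}
  (h : ∀ v ∈ chart (toricVariety b) (σ j), (fun k => v (σ k)) ∈ chart (toricVariety a) j)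

theorem comorphism_mk (f : MvPolynomial κ ℂ) :
    comorphism σ _ _ h (Ideal.Quotient.mk _ f) =
      Ideal.Quotient.mk _ (MvPolynomial.rename σ f) :=
  rfl

/-- Both charts sit in the same polynomial ring and the comorphism becomes an inclusion, so
identities can be checked on exponents. -/
theorem chartEmbedding_comorphism (hA : A.det ≠ 0)
    {e : ι → Fin 2 →₀ ℕ} (he : ∀ k r, (e k r : ℤ) = A.mulVec (b k - b (σ j)) r)
    (he' : ∀ k r, (e (σ k) r : ℤ) = A.mulVec (a k - a j) r)
    (x : coordRing (chart (toricVariety a) j)) :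
    chartEmbedding hA he (comorphism σ _ _ h x) =
      chartEmbedding (e := fun k => e (σ k)) hA he' x := by
  obtain ⟨f, rfl⟩ := Ideal.Quotient.mk_surjective x
  rw [comorphism_mk, chartEmbedding_mk, chartEmbedding_mk, monomialMap, MvPolynomial.aeval_rename]
  rfl

/-- An additive relation between exponents becomes a multiplicative one between coordinates. The
case `c = 0` gives an integral equation for `X u`; the case `N = 1` writes `X u` as a fraction. -/
theorem chart_prod_eq [Fintype κ] (hσ : ∀ k, b (σ k) = a k) (hA : A.det ≠ 0)
    (hpos : ∀ k r, 0 ≤ A.mulVec (b k - b (σ j)) r) {u : ι} {N : ℕ} {c c' : κ → ℕ}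
    (hc : N • (b u - b (σ j)) + ∑ k, c k • (a k - a j) = ∑ k, c' k • (a k - a j)) :
    comorphism σ _ _ h (Ideal.Quotient.mk _ (∏ k, MvPolynomial.X k ^ c k)) *
        Ideal.Quotient.mk _ (MvPolynomial.X u) ^ N =
      comorphism σ _ _ h (Ideal.Quotient.mk _ (∏ k, MvPolynomial.X k ^ c' k)) := by
  set e : ι → Fin 2 →₀ ℕ := fun k => toExponent (A.mulVec (b k - b (σ j)))
  have he : ∀ k r, (e k r : ℤ) = A.mulVec (b k - b (σ j)) r := fun k => toExponent_apply (hpos k)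
  have he' : ∀ k r, (e (σ k) r : ℤ) = A.mulVec (a k - a j) r := fun k r => by
    rw [he, hσ, hσ]
  apply chartEmbedding_injective hA he
  rw [map_mul, map_pow, chartEmbedding_comorphism h hA he he',
    chartEmbedding_comorphism h hA he he']
  simp only [chartEmbedding_mk, monomialMap, map_prod, map_pow, MvPolynomial.aeval_X,
    MvPolynomial.monomial_pow, one_pow, ← MvPolynomial.monomial_sum_one,
    MvPolynomial.monomial_mul, mul_one]
  refine congrArg (fun m => MvPolynomial.monomial m (1 : ℂ)) (Finsupp.ext fun r => ?_)
  have := congrFun (congrArg A.mulVec hc) r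
  simp only [Matrix.mulVec_add, Matrix.mulVec_sum, Matrix.mulVec_smul, Pi.add_apply,
    Finset.sum_apply, Pi.smul_apply, ← he, ← he'] at this
  simp only [nsmul_eq_mul] at this
  simp only [Finsupp.coe_add, Finsupp.coe_finsetSum, Pi.add_apply, Finset.sum_apply,
    Finsupp.smul_apply, smul_eq_mul]
  zify
  rw [add_comm]
  exact this

theorem comorphism_injective (hσ : ∀ k, b (σ k) = a k) (hA : A.det ≠ 0)
    (hpos : ∀ k r, 0 ≤ A.mulVec (b k - b (σ j)) r) :
    Function.Injective (comorphism σ _ _ h) := by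
  set e : ι → Fin 2 →₀ ℕ := fun k => toExponent (A.mulVec (b k - b (σ j)))
  have he : ∀ k r, (e k r : ℤ) = A.mulVec (b k - b (σ j)) r := fun k => toExponent_apply (hpos k)
  have he' : ∀ k r, (e (σ k) r : ℤ) = A.mulVec (a k - a j) r := fun k r => by
    rw [he, hσ, hσ]
  intro x y hxy
  apply chartEmbedding_injective hA he'
  rw [← chartEmbedding_comorphism h hA he he', hxy, chartEmbedding_comorphism h hA he he']

theorem comorphism_isIntegral [Fintype κ] (hσ : ∀ k, b (σ k) = a k) (hA : A.det ≠ 0)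
    (hpos : ∀ k r, 0 ≤ A.mulVec (b k - b (σ j)) r)
    (hfin : ∀ u, ∃ N : ℕ, 0 < N ∧ ∃ c : κ → ℕ,
      N • (b u - b (σ j)) = ∑ k, c k • (a k - a j)) :
    (comorphism σ _ _ h).toRingHom.IsIntegral := by
  intro x
  obtain ⟨f, rfl⟩ := Ideal.Quotient.mk_surjective x
  induction f using MvPolynomial.induction_on with
  | C r =>
    have : Ideal.Quotient.mk _ (MvPolynomial.C r) = (comorphism σ _ _ h).toRingHom
      (algebraMap ℂ _ r) := ((comorphism σ _ _ h).commutes r).symm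
    rw [this]
    exact RingHom.isIntegralElem_map _
  | add p q hp hq =>
    rw [map_add]
    exact RingHom.IsIntegralElem.add _ hp hq
  | mul_X p u hp =>
    rw [map_mul]
    refine RingHom.IsIntegralElem.mul _ hp ?_
    obtain ⟨N, hN, c, hc⟩ := hfin u
    have key := chart_prod_eq h hσ hA hpos (u := u) (N := N) (c := 0) (c' := c) (by simpa using hc)
    simp only [Pi.zero_apply, pow_zero, Finset.prod_const_one, map_one, one_mul] at key
    let := (comorphism σ _ _ h).toRingHom.toAlgebra
    refine IsIntegral.of_pow hN ?_
    rw [key]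
    exact RingHom.isIntegralElem_map _

/-- The hypotheses split by role: `hcone` gives normality, `hfin` finiteness and `hgrp` equality of
the fraction fields. -/
theorem isAffineNormalization_comorphism [Finite ι] [Fintype κ] (hσ : ∀ k, b (σ k) = a k)
    (hA : A.det ≠ 0) (hpos : ∀ k r, 0 ≤ A.mulVec (b k - b (σ j)) r)
    (hcone : ∀ u, (∀ r, 0 ≤ A.mulVec u r) →
      u ∈ AddSubmonoid.closure (Set.range fun k => b k - b (σ j)))
    (hfin : ∀ u, ∃ N : ℕ, 0 < N ∧ ∃ c : κ → ℕ,
      N • (b u - b (σ j)) = ∑ k, c k • (a k - a j))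
    (hgrp : ∀ u, ∃ c c' : κ → ℕ,
      (b u - b (σ j)) + ∑ k, c k • (a k - a j) = ∑ k, c' k • (a k - a j)) :
    IsAffineNormalization (comorphism σ _ _ h) := by
  set e : ι → Fin 2 →₀ ℕ := fun k => toExponent (A.mulVec (b k - b (σ j)))
  have he : ∀ k r, (e k r : ℤ) = A.mulVec (b k - b (σ j)) r := fun k => toExponent_apply (hpos k)
  have he' : ∀ k r, (e (σ k) r : ℤ) = A.mulVec (a k - a j) r := fun k r => by
    rw [he, hσ, hσ]
  have hinj' := chartEmbedding_injective hA he'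
  have hdom : IsDomain (coordRing (chart (toricVariety a) j)) := hinj'.isDomain _
  refine ⟨hdom, (chartEmbedding_injective hA he).isDomain _,
    isIntegrallyClosed_coordRing_chart hA hpos hcone, ?_, comorphism_injective h hσ hA hpos, ?_⟩
  · refine RingHom.IsIntegral.to_finite (comorphism_isIntegral h hσ hA hpos hfin) ?_
    refine RingHom.FiniteType.of_comp_finiteType (f := algebraMap ℂ _) ?_
    have : (comorphism σ _ _ h).toRingHom.comp (algebraMap ℂ _) = algebraMap ℂ _ :=
      (comorphism σ _ _ h).comp_algebraMap
    rw [this]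
    exact RingHom.finiteType_algebraMap.2 inferInstance
  · intro x
    obtain ⟨f, rfl⟩ := Ideal.Quotient.mk_surjective x
    induction f using MvPolynomial.induction_on with
    | C r =>
      exact ⟨algebraMap ℂ _ r, 1, one_ne_zero, by
        rw [map_one, one_mul, (comorphism σ _ _ h).commutes r]; rfl⟩
    | add p q hp hq =>
      obtain ⟨x, s, hs, hx⟩ := hp
      obtain ⟨y, t, ht, hy⟩ := hq
      refine ⟨t * x + s * y, s * t, mul_ne_zero hs ht, ?_⟩
      rw [map_add, map_mul, map_add, map_mul, map_mul, ← hx, ← hy]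
      ring
    | mul_X p u hp =>
      obtain ⟨x, s, hs, hx⟩ := hp
      obtain ⟨c, c', hc⟩ := hgrp u
      have key := chart_prod_eq h hσ hA hpos (u := u) (N := 1) (c := c) (c' := c')
        (by rwa [one_smul])
      rw [pow_one] at key
      refine ⟨x * Ideal.Quotient.mk _ (∏ k, MvPolynomial.X k ^ c' k),
        s * Ideal.Quotient.mk _ (∏ k, MvPolynomial.X k ^ c k), mul_ne_zero hs ?_, ?_⟩
      · intro h0
        have := congrArg (chartEmbedding hA he') h0
        rw [map_zero, chartEmbedding_mk, map_prod, Finset.prod_eq_zero_iff] at this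
        obtain ⟨k, -, hk⟩ := this
        rw [map_pow, monomialMap, MvPolynomial.aeval_X] at hk
        simpa using eq_zero_of_pow_eq_zero hk
      · rw [map_mul, map_mul, map_mul, ← key, ← hx]
        ring

end Normalization

end ToricInterpolation

/-! ### Lifting points along finite morphisms -/

/-- The maximal ideal `ker v` has a maximal ideal `Q` above it. The field `B ⧸ Q` is integral over
the algebraically closed field `k`, hence equal to it, and the quotient map is the lift. -/
theorem AlgHom.exists_comp_eq_of_isIntegral {k A B : Type*} [Field k] [IsAlgClosed k] [CommRing A]
    [CommRing B] [Algebra k A] [Algebra k B] (φ : A →ₐ[k] B) (hinj : Function.Injective φ)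
    (hint : φ.toRingHom.IsIntegral) (v : A →ₐ[k] k) : ∃ w : B →ₐ[k] k, w.comp φ = v := by
  let := φ.toRingHom.toAlgebra
  have : Algebra.IsIntegral A B := ⟨hint⟩
  have hv : Function.Surjective v := fun z => ⟨algebraMap k A z, v.commutes z⟩
  have hmax : (RingHom.ker v).IsMaximal := RingHom.ker_isMaximal_of_surjective v hv
  obtain ⟨Q, hQ, hcomap⟩ := Ideal.exists_ideal_over_maximal_of_isIntegral (S := B) (RingHom.ker v)
    (fun x hx => by
      have : φ x = 0 := hx
      rw [(map_eq_zero_iff φ hinj).1 this]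
      exact zero_mem _)
  let := Ideal.Quotient.field Q
  have hφ : ∀ a, Ideal.Quotient.mk Q (φ a) = algebraMap k (B ⧸ Q) (v a) := fun a => by
    have ha : a - algebraMap k A (v a) ∈ RingHom.ker v := by
      rw [RingHom.mem_ker, map_sub, v.commutes]
      exact sub_self _
    rw [← hcomap] at ha
    have : φ (a - algebraMap k A (v a)) ∈ Q := ha
    rw [map_sub, φ.commutes, ← Ideal.Quotient.eq] at this
    exact this
  have hbij : Function.Bijective (algebraMap k (B ⧸ Q)) := by
    refine IsAlgClosed.ringHom_bijective_of_isIntegral _ fun x => ?_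
    obtain ⟨y, rfl⟩ := Ideal.Quotient.mk_surjective x
    obtain ⟨p, hp, hpy⟩ := hint y
    refine ⟨p.map v.toRingHom, hp.map _, ?_⟩
    rw [Polynomial.eval₂_map]
    have : (algebraMap k (B ⧸ Q)).comp v.toRingHom =
        (Ideal.Quotient.mk Q).comp φ.toRingHom := RingHom.ext fun a => (hφ a).symm
    rw [this, ← Polynomial.hom_eval₂, hpy, map_zero]
  let E : k ≃ₐ[k] (B ⧸ Q) := AlgEquiv.ofBijective (Algebra.ofId k (B ⧸ Q)) hbij
  refine ⟨E.symm.toAlgHom.comp (Ideal.Quotient.mkₐ k Q), AlgHom.ext fun a => ?_⟩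
  change E.symm (Ideal.Quotient.mk Q (φ a)) = v a
  rw [hφ, AlgEquiv.symm_apply_eq]
  rfl

namespace ToricInterpolation

theorem zpow_finsetSum {G κ : Type*} [CommGroup G] (x : G) (s : Finset κ) (f : κ → ℤ) :
    x ^ (∑ k ∈ s, f k) = ∏ k ∈ s, x ^ f k := by
  classical
  induction s using Finset.induction_on with
  | empty => simp
  | insert k s hk ih => rw [Finset.sum_insert hk, Finset.prod_insert hk, zpow_add, ih]

theorem coordProj_torusAct {m : ℕ} {ι κ : Type*} {b : ι → Fin m → ℤ} {a : κ → Fin m → ℤ}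
    {σ : κ → ι} (hσ : ∀ k, b (σ k) = a k) (t : Fin m → ℂˣ) (p : ℙ ℂ (ι → ℂ))
    (h : (fun k => p.rep (σ k)) ≠ 0) (h' : (fun k => (torusAct b t p).rep (σ k)) ≠ 0) :
    coordProj σ (torusAct b t p) h' = torusAct a t (coordProj σ p h) := by
  have hrep : torusAct b t p = Projectivization.mk ℂ (torusLin b t p.rep)
      ((map_ne_zero_iff _ (torusLin_injective b t)).2 p.rep_nonzero) := by
    conv_lhs => rw [← p.mk_rep]
    exact Projectivization.map_mk _ _ _ _
  obtain ⟨c, hc⟩ := Projectivization.exists_smul_eq_mk_rep ℂ (torusLin b t p.rep)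
    ((map_ne_zero_iff _ (torusLin_injective b t)).2 p.rep_nonzero)
  rw [← hrep] at hc
  rw [coordProj, coordProj, show torusAct a t _ = Projectivization.map _ _ _ from rfl, Projectivization.map_mk, Projectivization.mk_eq_mk_iff]
  refine ⟨c, ?_⟩
  ext k
  rw [← hc]
  simp [torusLin, hσ]

/-! ### Image and equivariance of the projection -/

section Projection

variable {m : ℕ} {ι κ : Type*} [Nonempty ι] {b : ι → Fin m → ℤ}
  {a : κ → Fin m → ℤ} {σ : κ → ι}

/-- The relation `hconv` yields a binomial vanishing on the variety that equates a power of the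
coordinate `u` with a nonconstant monomial in the kept coordinates. If these all vanish, so does
every coordinate. -/
theorem exists_ne_zero_of_mem_toricVariety [Fintype κ] (hσ : ∀ k, b (σ k) = a k)
    (hconv : ∀ u, ∃ c : κ → ℕ, 0 < ∑ k, c k ∧ (∑ k, c k) • b u = ∑ k, c k • a k)
    {p : ℙ ℂ (ι → ℂ)} (hp : p ∈ toricVariety b) : (fun k => p.rep (σ k)) ≠ 0 := by
  intro h0
  obtain ⟨u, hu⟩ := Function.ne_iff.1 p.rep_nonzero
  obtain ⟨c, hc0, hc⟩ := hconv u
  have hom : (MvPolynomial.X u ^ (∑ k, c k) -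
      ∏ k, MvPolynomial.X (σ k) ^ c k : MvPolynomial ι ℂ).IsHomogeneous (∑ k, c k) :=
    (MvPolynomial.isHomogeneous_X_pow u _).sub (MvPolynomial.IsHomogeneous.prod _ _ _
      fun k _ => MvPolynomial.isHomogeneous_X_pow (σ k) _)
  have key := (mem_toricVariety_iff b p).1 hp _ _ hom fun t => by
    simp only [map_sub, map_pow, map_prod, MvPolynomial.eval_X, sub_eq_zero, monomialVec,
      ← Units.val_pow_eq_pow_val, ← Units.coe_prod]
    congr 1
    simp only [← Finset.prod_pow, hσ]
    rw [Finset.prod_comm]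
    refine Finset.prod_congr rfl fun l _ => ?_
    have hl := congrFun hc l
    simp only [Pi.smul_apply, Finset.sum_apply, nsmul_eq_mul] at hl
    simp only [← zpow_natCast, ← zpow_mul]
    rw [mul_comm, hl, zpow_finsetSum]
    exact Finset.prod_congr rfl fun k _ => by rw [mul_comm]; rfl
  have hz : ∀ k, p.rep (σ k) = 0 := congrFun h0
  obtain ⟨k, -, hk⟩ := Finset.exists_ne_zero_of_sum_ne_zero hc0.ne'
  simp only [map_sub, map_pow, map_prod, MvPolynomial.eval_X, hz] at key
  rw [Finset.prod_eq_zero (Finset.mem_univ k) (zero_pow hk), sub_zero] at key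
  exact hu (eq_zero_of_pow_eq_zero key)

variable [Nonempty κ]

theorem mk_comp_mem_toricVariety (hσ : ∀ k, b (σ k) = a k) {v : ι → ℂ} (hv0 : v ≠ 0)
    (hv : Projectivization.mk ℂ v hv0 ∈ toricVariety b) (h0 : (fun k => v (σ k)) ≠ 0) :
    Projectivization.mk ℂ (fun k => v (σ k)) h0 ∈ toricVariety a := by
  rw [mk_mem_toricVariety_iff] at hv ⊢
  intro n f hf hfa
  have key : ∀ w : ι → ℂ, MvPolynomial.eval w (MvPolynomial.rename σ f) =
      MvPolynomial.eval (fun k => w (σ k)) f := fun w => MvPolynomial.eval_rename _ _ _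
  rw [← key]
  refine hv n _ hf.rename_isHomogeneous fun t => ?_
  rw [key]
  convert hfa t using 2
  simp only [monomialVec, hσ]
  rfl

theorem comp_mem_chart (hσ : ∀ k, b (σ k) = a k) (j : κ) :
    ∀ v ∈ chart (toricVariety b) (σ j), (fun k => v (σ k)) ∈ chart (toricVariety a) j := by
  rintro v ⟨hv1, hv0, hv⟩
  have h0 : (fun k => v (σ k)) ≠ 0 := fun h => by
    have := congrFun h j
    simp [hv1] at this
  exact ⟨hv1, h0, mk_comp_mem_toricVariety hσ hv0 hv h0⟩

theorem torusAct_mem_toricVariety (t : Fin m → ℂˣ) {p : ℙ ℂ (ι → ℂ)}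
    (hp : p ∈ toricVariety b) : torusAct b t p ∈ toricVariety b := by
  have hrep : torusAct b t p = Projectivization.mk ℂ (torusLin b t p.rep)
      ((map_ne_zero_iff _ (torusLin_injective b t)).2 p.rep_nonzero) := by
    conv_lhs => rw [← p.mk_rep]
    exact Projectivization.map_mk _ _ _ _
  rw [hrep, mk_mem_toricVariety_iff]
  intro n f hf hfb
  have key : ∀ (w : ι → ℂ) (g : MvPolynomial ι ℂ), MvPolynomial.eval w (MvPolynomial.aeval
      (fun j => MvPolynomial.C (monomialVec b t j) * MvPolynomial.X j : ι → MvPolynomial ι ℂ) g) =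
      MvPolynomial.eval (torusLin b t w) g := fun w g => by
    induction g using MvPolynomial.induction_on with
    | C r => simp
    | add p q hp hq => rw [map_add, map_add, map_add, hp, hq]
    | mul_X p k hp =>
      rw [map_mul, map_mul, map_mul, hp, MvPolynomial.aeval_X, map_mul, MvPolynomial.eval_C,
        MvPolynomial.eval_X, MvPolynomial.eval_X]
      rfl
  rw [← key]
  refine (mem_toricVariety_iff b p).1 hp (1 * n) _ (hf.aeval _ fun j => ?_) fun s => ?_
  · exact zero_add 1 ▸ (MvPolynomial.isHomogeneous_C _ _).mul (MvPolynomial.isHomogeneous_X _ _)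
  · rw [key]
    rw [← hfb (t * s)]
    refine congrArg (fun v => MvPolynomial.eval v f) (funext fun j => ?_)
    simp [torusLin, monomialVec, mul_zpow, Finset.prod_mul_distrib]

end Projection

theorem projectsOnto_toricVariety {ι κ : Type*} [Nonempty ι] [Nonempty κ] [Fintype κ]
    {b : ι → Fin 2 → ℤ} {a : κ → Fin 2 → ℤ} {σ : κ → ι} (hinj : Function.Injective σ)
    (hσ : ∀ k, b (σ k) = a k)
    (hconv : ∀ u, ∃ c : κ → ℕ, 0 < ∑ k, c k ∧ (∑ k, c k) • b u = ∑ k, c k • a k)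
    (hpos : ∀ j, ∃ A : Matrix (Fin 2) (Fin 2) ℤ, A.det ≠ 0 ∧
      ∀ u r, 0 ≤ A.mulVec (b u - b (σ j)) r) :
    ProjectsOnto σ (toricVariety b) (toricVariety a) where
  injective := hinj
  off_center p hp := exists_ne_zero_of_mem_toricVariety hσ hconv hp
  image_eq := by
    ext q
    constructor
    · rintro ⟨p, hp, h0, rfl⟩
      refine mk_comp_mem_toricVariety hσ p.rep_nonzero ?_ h0
      rwa [Projectivization.mk_rep]
    · intro hq
      obtain ⟨j, hj⟩ := Function.ne_iff.1 q.rep_nonzero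
      have hj : q.rep j ≠ 0 := hj
      set v : κ → ℂ := (q.rep j)⁻¹ • q.rep with hv
      have hvj : v j = 1 := inv_mul_cancel₀ hj
      have hv0 : v ≠ 0 := fun h => by simp [h] at hvj
      have hvq : Projectivization.mk ℂ v hv0 = q := by
        conv_rhs => rw [← q.mk_rep]
        exact (Projectivization.mk_eq_mk_iff' ℂ _ _ _ _).2 ⟨_, rfl⟩
      have hvc : v ∈ chart (toricVariety a) j := ⟨hvj, hv0, hvq ▸ hq⟩
      obtain ⟨A, hA, hAp⟩ := hpos j
      have hmaps := comp_mem_chart hσ j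
      have hint := comorphism_isIntegral hmaps hσ hA hAp fun u => by
        obtain ⟨c, hc0, hc⟩ := hconv u
        refine ⟨_, hc0, c, ?_⟩
        simp only [smul_sub, hc, Finset.sum_sub_distrib, hσ, Finset.sum_smul]
      -- The normalized point `v` is a `ℂ`-point of the chart of the target; its lift `w` is read
      -- off on the coordinates as a point `x` above it.
      obtain ⟨w, hw⟩ := AlgHom.exists_comp_eq_of_isIntegral _ (comorphism_injective hmaps hσ hA hAp)
        hint (Ideal.Quotient.liftₐ _ (MvPolynomial.aeval v) fun f hf =>
          (MvPolynomial.mem_vanishingIdeal_iff.1 hf) v hvc)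
      set x : ι → ℂ := fun u => w (Ideal.Quotient.mk _ (MvPolynomial.X u)) with hx
      have hxf : ∀ f, MvPolynomial.eval x f = w (Ideal.Quotient.mk _ f) := fun f => by
        have : (MvPolynomial.aeval x : MvPolynomial ι ℂ →ₐ[ℂ] ℂ) =
            w.comp (Ideal.Quotient.mkₐ ℂ _) := MvPolynomial.algHom_ext fun u => by simp [hx]
        exact DFunLike.congr_fun this f
      have hxσ : (fun k => x (σ k)) = v := funext fun k => by
        have := DFunLike.congr_fun hw (Ideal.Quotient.mk _ (MvPolynomial.X k))
        simpa [comorphism_mk, hx] using this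
      have hx0 : x ≠ 0 := fun h => hv0 (by rw [← hxσ, h]; rfl)
      have hxX : Projectivization.mk ℂ x hx0 ∈ toricVariety b := by
        rw [mk_mem_toricVariety_iff]
        intro n f hf hfb
        rw [hxf, Ideal.Quotient.eq_zero_iff_mem.2, map_zero]
        rw [MvPolynomial.mem_vanishingIdeal_iff]
        rintro y ⟨-, hy0, hy⟩
        exact (mk_mem_toricVariety_iff b y hy0).1 hy n f hf hfb
      have hoff := exists_ne_zero_of_mem_toricVariety hσ hconv hxX
      refine ⟨_, hxX, hoff, ?_⟩
      obtain ⟨c, hc⟩ := Projectivization.exists_smul_eq_mk_rep ℂ x hx0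
      rw [← hvq, coordProj, Projectivization.mk_eq_mk_iff]
      refine ⟨c, ?_⟩
      rw [← hc, ← hxσ]
      rfl


/-! ### Lattice points of a configuration -/

theorem le_of_mem_latticePoints {ι : Type*} {a : ι → Fin 2 → ℤ} {p q c : ℤ}
    (h : ∀ j, c ≤ p * a j 0 + q * a j 1) {u : Fin 2 → ℤ} (hu : u ∈ latticePoints a) :
    c ≤ p * u 0 + q * u 1 := by
  let L : (Fin 2 → ℝ) →ₗ[ℝ] ℝ := (p : ℝ) • LinearMap.proj 0 + (q : ℝ) • LinearMap.proj 1
  have hL : ∀ w : Fin 2 → ℝ, L w = p * w 0 + q * w 1 := fun w => by simp [L]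
  have : convexHull ℝ (Set.range fun (j : ι) (k : Fin 2) => (a j k : ℝ)) ⊆ L ⁻¹' Set.Ici (c : ℝ) := by
    refine convexHull_min ?_ ((convex_Ici (c : ℝ)).linear_preimage L)
    rintro _ ⟨j, rfl⟩
    rw [Set.mem_preimage, Set.mem_Ici, hL]
    change (c : ℝ) ≤ p * (a j 0 : ℝ) + q * (a j 1 : ℝ)
    exact_mod_cast h j
  have := this hu
  rw [Set.mem_preimage, Set.mem_Ici, hL] at this
  exact_mod_cast this

theorem mem_latticePoints_of_nsmul_eq {m : ℕ} {ι : Type*} [Fintype ι] {a : ι → Fin m → ℤ}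
    {u : Fin m → ℤ} {c : ι → ℕ} (hc : 0 < ∑ k, c k) (h : (∑ k, c k) • u = ∑ k, c k • a k) :
    u ∈ latticePoints a := by
  have hN : (0 : ℝ) < ∑ k, (c k : ℝ) := by exact_mod_cast hc
  have key : (fun k => (u k : ℝ)) =
      ∑ j, ((c j : ℝ) / ∑ k, (c k : ℝ)) • fun k => (a j k : ℝ) := by
    ext l
    have hl := congrFun h l
    simp only [Pi.smul_apply, Finset.sum_apply, nsmul_eq_mul, Pi.mul_apply, Pi.natCast_apply] at hl
    have hl' : (∑ k, (c k : ℝ)) * u l = ∑ k, (c k : ℝ) * a k l := by exact_mod_cast hl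
    simp only [Finset.sum_apply, Pi.smul_apply, smul_eq_mul, div_mul_eq_mul_div]
    rw [← Finset.sum_div, ← hl', mul_div_cancel_left₀ _ hN.ne']
  change (fun k => (u k : ℝ)) ∈ convexHull ℝ _
  rw [key]
  refine (convex_convexHull ℝ _).sum_mem (fun j _ => by positivity) ?_
    fun j _ => subset_convexHull ℝ _ ⟨j, rfl⟩
  rw [← Finset.sum_div, div_self hN.ne']

/-- The indices may coincide; their weights then add up. -/
theorem exists_sum_smul_eq_three {ι M : Type*} [Fintype ι] [AddCommMonoid M] (i j l : ι)
    (α β γ : ℕ) :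
    ∃ c : ι → ℕ, ∑ k, c k = α + β + γ ∧
      ∀ a : ι → M, ∑ k, c k • a k = α • a i + β • a j + γ • a l := by
  classical
  refine ⟨fun k => (if k = i then α else 0) + (if k = j then β else 0) + if k = l then γ else 0,
    ?_, fun a => ?_⟩
  · simp [Finset.sum_add_distrib]
  · simp [Finset.sum_add_distrib, add_smul, ite_smul]

/-! ### The second interpolant of the rational normal curve -/

variable {d : ℕ}

theorem secondInterpolant_zero (j : Fin (d + 1)) : secondInterpolant d j 0 = (j : ℤ) := by
  simp [secondInterpolant, curveInterpolant]

theorem secondInterpolant_one (j : Fin (d + 1)) :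
    secondInterpolant d j 1 = ((j : ℕ).choose 2 : ℤ) := by
  simp [secondInterpolant, curveInterpolant]

theorem two_mul_choose_two (n : ℕ) : 2 * (n.choose 2 : ℤ) = n * (n - 1) := by
  induction n with
  | zero => simp
  | succ n ih =>
    rw [Nat.choose_succ_succ' n 1, Nat.choose_one_right]
    push_cast
    linarith

theorem two_mul_secondInterpolant_one (j : Fin (d + 1)) :
    2 * secondInterpolant d j 1 = (j : ℤ) * (j - 1) := by
  rw [secondInterpolant_one, two_mul_choose_two]

theorem secondInterpolant_injective : Function.Injective (secondInterpolant d) := fun i j h => by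
  have := congrFun h 0
  rw [secondInterpolant_zero, secondInterpolant_zero] at this
  exact Fin.ext (by exact_mod_cast this)

theorem eq_secondInterpolant {u : Fin 2 → ℤ} {j : Fin (d + 1)} (h0 : u 0 = (j : ℤ))
    (h1 : 2 * u 1 = (j : ℤ) * (j - 1)) : u = secondInterpolant d j := by
  ext r
  fin_cases r
  · exact h0.trans (secondInterpolant_zero j).symm
  · have := two_mul_secondInterpolant_one j
    change u 1 = secondInterpolant d j 1
    linarith

/-- The inequalities which define the polygon spanned by the second interpolant. -/
def InPolygon (d : ℕ) (u : Fin 2 → ℤ) : Prop :=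
  0 ≤ u 0 ∧ u 0 ≤ d ∧ u 0 * (u 0 - 1) ≤ 2 * u 1 ∧ 2 * u 1 ≤ u 0 * (d - 1)

/-- With `n = j - q` this says that the parabola lies on or above its chord through `q` and `q + 1`
at every integer. It is the source of the lower bounds on `y` below. -/
theorem mul_pred_nonneg (n : ℤ) : 0 ≤ n * (n - 1) := by
  rcases le_or_gt n 0 with h | h
  · exact mul_nonneg_of_nonpos_of_nonpos h (by lia)
  · exact mul_nonneg h.le (by lia)

theorem inPolygon_of_mem_latticePoints {u : Fin 2 → ℤ}
    (hu : u ∈ latticePoints (secondInterpolant d)) : InPolygon d u := by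
  have hj : ∀ j : Fin (d + 1), (0 : ℤ) ≤ j ∧ (j : ℤ) ≤ d := fun j => ⟨by positivity, by
    exact_mod_cast Nat.lt_succ_iff.1 j.2⟩
  refine ⟨?_, ?_, ?_, ?_⟩
  · have := le_of_mem_latticePoints (p := 1) (q := 0) (c := 0) (fun j => by
      rw [secondInterpolant_zero]; linarith [hj j]) hu
    linarith
  · have := le_of_mem_latticePoints (p := -1) (q := 0) (c := -d) (fun j => by
      rw [secondInterpolant_zero]; linarith [hj j]) hu
    linarith
  -- The supporting line depends on `u`: it passes through the parabola points with abscissas `u 0`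
  -- and `u 0 + 1`.
  · have := le_of_mem_latticePoints (p := -2 * u 0) (q := 2) (c := -(u 0 * (u 0 + 1)))
      (fun j => by
        rw [secondInterpolant_zero, two_mul_secondInterpolant_one]
        linarith [mul_pred_nonneg (j - u 0)]) hu
    linarith
  · have := le_of_mem_latticePoints (p := d - 1) (q := -2) (c := 0) (fun j => by
      rw [secondInterpolant_zero, neg_mul, two_mul_secondInterpolant_one]
      nlinarith [hj j]) hu
    linarith

theorem exists_convex_combination {u : Fin 2 → ℤ} (hu : InPolygon d u) :
    ∃ c : Fin (d + 1) → ℕ, 0 < ∑ k, c k ∧ (∑ k, c k) • u = ∑ k, c k • secondInterpolant d k := by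
  obtain ⟨h0, hd, hlo, hhi⟩ := hu
  obtain ⟨x, hx⟩ := Int.eq_ofNat_of_zero_le h0
  have hxd : x ≤ d := by rw [hx] at hd; exact_mod_cast hd
  let X : Fin (d + 1) := ⟨x, Nat.lt_succ_of_le hxd⟩
  by_cases hxx : u = secondInterpolant d X
  · obtain ⟨c, hc, hca⟩ := exists_sum_smul_eq_three (M := Fin 2 → ℤ) X X X 1 0 0
    exact ⟨c, by rw [hc]; norm_num, by rw [hc, hca, hxx]; simp⟩
  -- The columns `0` and `d` contain only a vertex. There the weights used below would all vanish.
  have hx0 : (0 : ℤ) < x := by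
    rcases Nat.eq_zero_or_pos x with rfl | h
    · refine absurd (eq_secondInterpolant (j := X) (by simpa [X] using hx) ?_) hxx
      rw [hx] at hlo hhi
      simp [X] at hlo hhi ⊢
      lia
    · exact_mod_cast h
  have hxd : (x : ℤ) < d := by
    rcases hxd.eq_or_lt with h | h
    · refine absurd (eq_secondInterpolant (j := X) (by simpa [X] using hx) ?_) hxx
      rw [hx] at hlo hhi
      rw [← h] at hhi
      exact le_antisymm hhi hlo
    · exact_mod_cast h
  have hx : u 0 = (x : ℤ) := hx
  rw [hx] at hlo hhi
  obtain ⟨e, he⟩ := Int.eq_ofNat_of_zero_le (sub_nonneg.2 hlo)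
  obtain ⟨f, hf⟩ := Int.eq_ofNat_of_zero_le (sub_nonneg.2 hhi)
  obtain ⟨z, hz⟩ := Int.eq_ofNat_of_zero_le (sub_nonneg.2 hxd.le)
  have he : 2 * u 1 - x * (x - 1) = (e : ℤ) := he
  have hf : (x : ℤ) * (d - 1) - 2 * u 1 = (f : ℤ) := hf
  have hz : (d : ℤ) - x = (z : ℤ) := hz
  have hsum : (d : ℤ) * f + e * x + e * z = d * (x * z) := by
    rw [← he, ← hf, ← hz]; ring
  -- `u` lies on the vertical segment from the parabola point `X` to the upper edge, at doubled
  -- distances `e` and `f` from its ends. The upper end divides the edge from `0` to `d` in the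
  -- ratio `x : z`, whence these weights after clearing the denominator.
  obtain ⟨c, hc, hca⟩ := exists_sum_smul_eq_three (M := Fin 2 → ℤ) X (Fin.last d) 0 (d * f) (e * x)
    (e * z)
  have hpos : 0 < d * f + e * x + e * z := by
    zify
    rw [hsum, ← hz]
    exact mul_pos (hx0.trans hxd) (mul_pos hx0 (sub_pos.2 hxd))
  refine ⟨c, hc ▸ hpos, ?_⟩
  rw [hc, hca]
  ext r
  fin_cases r
  · simp only [Fin.zero_eta, Pi.add_apply, Pi.smul_apply, secondInterpolant_zero, hx, X,
      Fin.val_last, Fin.val_zero]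
    simp only [nsmul_eq_mul]
    push_cast
    rw [hsum, ← he, ← hf, ← hz]
    ring
  · have h1 := two_mul_secondInterpolant_one X
    have h2 := two_mul_secondInterpolant_one (Fin.last d)
    have h3 := two_mul_secondInterpolant_one (0 : Fin (d + 1))
    simp only [X, Fin.val_last, Fin.val_zero] at h1 h2 h3
    apply mul_left_cancel₀ (two_ne_zero (α := ℤ))
    simp only [Fin.mk_one, Pi.add_apply, Pi.smul_apply]
    simp only [nsmul_eq_mul]
    rw [mul_add, mul_add, mul_left_comm, mul_left_comm 2 _ (secondInterpolant d X 1),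
      mul_left_comm 2 _ (secondInterpolant d (Fin.last d) 1),
      mul_left_comm 2 _ (secondInterpolant d 0 1), h1, h2, h3]
    push_cast
    rw [hsum, ← hf, ← hz]
    have : 2 * u 1 = e + x * (x - 1) := by linarith
    rw [this]
    ring

theorem mem_latticePoints_iff {u : Fin 2 → ℤ} :
    u ∈ latticePoints (secondInterpolant d) ↔ InPolygon d u :=
  ⟨inPolygon_of_mem_latticePoints, fun h => by
    obtain ⟨c, hc, hca⟩ := exists_convex_combination h
    exact mem_latticePoints_of_nsmul_eq hc hca⟩

theorem exists_group_combination (hd : 3 ≤ d) (u : Fin 2 → ℤ) (j : Fin (d + 1)) :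
    ∃ c c' : Fin (d + 1) → ℕ,
      (u - secondInterpolant d j) + ∑ k, c k • (secondInterpolant d k - secondInterpolant d j) =
        ∑ k, c' k • (secondInterpolant d k - secondInterpolant d j) := by
  let i1 : Fin (d + 1) := ⟨1, by lia⟩
  let i2 : Fin (d + 1) := ⟨2, by lia⟩
  -- The barycentric coordinates of `u` with respect to `(0,0)`, `(1,0)`, `(2,1)` are integers with
  -- sum `1`. Their negative parts go into `c`, their positive parts into `c'`.
  obtain ⟨c, -, hc⟩ := exists_sum_smul_eq_three (M := Fin 2 → ℤ) 0 i1 i2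
    (-(1 - u 0 + u 1)).toNat (-(u 0 - 2 * u 1)).toNat (-u 1).toNat
  obtain ⟨c', -, hc'⟩ := exists_sum_smul_eq_three (M := Fin 2 → ℤ) 0 i1 i2
    (1 - u 0 + u 1).toNat (u 0 - 2 * u 1).toNat (u 1).toNat
  refine ⟨c, c', ?_⟩
  rw [hc, hc', ← sub_eq_zero]
  have e0 := Int.toNat_sub_toNat_neg (1 - u 0 + u 1)
  have e1 := Int.toNat_sub_toNat_neg (u 0 - 2 * u 1)
  have e2 := Int.toNat_sub_toNat_neg (u 1)
  ext r
  have key : ∀ p q s w : ℤ, w = (1 - u 0 + u 1) * p + (u 0 - 2 * u 1) * q + u 1 * s →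
      w + (((-(1 - u 0 + u 1)).toNat : ℤ) * p + ((-(u 0 - 2 * u 1)).toNat : ℤ) * q +
        ((-u 1).toNat : ℤ) * s) - (((1 - u 0 + u 1).toNat : ℤ) * p +
        ((u 0 - 2 * u 1).toNat : ℤ) * q + ((u 1).toNat : ℤ) * s) = 0 := by
    intro p q s w hw
    rw [hw]
    linear_combination -p * e0 - q * e1 - s * e2
  simp only [Pi.add_apply, Pi.sub_apply, Pi.smul_apply, Pi.zero_apply]
  simp only [nsmul_eq_mul]
  apply key
  fin_cases r
  · simp only [Fin.zero_eta, secondInterpolant_zero, i1, i2, Fin.val_zero]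
    push_cast
    ring
  · simp only [Fin.mk_one, secondInterpolant_one, i1, i2, Fin.val_zero]
    simp
    ring

/-! ### The vertex cones -/

/-- This is the cone at the end vertex `a 0`, generated by the first two columns of the polygon.
From a higher column one subtracts `(1, 0)` when `y` is low and `(2, d - 1)` when `y ≥ d - 1`. A
point allowing neither lies in column `2`, where `y = 0` is not needed since `(2, 0)` is twice `(1,
0)`. -/
theorem mem_of_vertex_cone (hd : 3 ≤ d) (S : AddSubmonoid (ℤ × ℤ))
    (h1 : ∀ y : ℤ, 0 ≤ y → 2 * y ≤ d - 1 → (1, y) ∈ S)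
    (h2 : ∀ y : ℤ, 1 ≤ y → y ≤ d - 1 → (2, y) ∈ S) (n : ℕ) (y : ℤ) (hy : 0 ≤ y)
    (hyn : 2 * y ≤ (d - 1) * n) : ((n : ℤ), y) ∈ S := by
  have hd' : (3 : ℤ) ≤ d := by exact_mod_cast hd
  induction n using Nat.strong_induction_on generalizing y with
  | _ n ih =>
    rcases n with _ | _ | n
    · have : y = 0 := by simp at hyn; lia
      subst this
      exact zero_mem S
    · exact h1 y hy (by simpa using hyn)
    · push_cast at hyn
      by_cases hc : 2 * y ≤ (d - 1) * (n + 1)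
      · have := add_mem (ih (n + 1) (by lia) y hy (by push_cast; exact hc)) (h1 0 le_rfl (by lia))
        convert this using 1
        ext <;> simp
      · by_cases hc' : (d : ℤ) - 1 ≤ y
        · have := add_mem (ih n (by lia) (y - (d - 1)) (by lia) (by linarith))
            (h2 (d - 1) (by lia) le_rfl)
          convert this using 1
          ext <;> simp
          ring
        · have hn : n = 0 := by
            by_contra hn
            have : (1 : ℤ) ≤ n := by exact_mod_cast Nat.one_le_iff_ne_zero.2 hn
            nlinarith
          subst hn
          refine h2 y ?_ (by lia)
          push_cast at hc
          lia

/-- The primitive forms which define the cone at the vertex with index `j`. -/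
def vertexForms (d : ℕ) (j : Fin (d + 1)) : Matrix (Fin 2) (Fin 2) ℤ :=
  if j = 0 then !![0, 1; (d : ℤ) - 1, -2]
  else if j = Fin.last d then !![1 - (d : ℤ), 1; (d : ℤ) - 1, -2]
  else !![1 - (j : ℤ), 1; -(j : ℤ), 1]

theorem mulVec_fin_two (p q r s : ℤ) (u : Fin 2 → ℤ) :
    (∀ i, 0 ≤ (!![p, q; r, s]).mulVec u i) ↔
      0 ≤ p * u 0 + q * u 1 ∧ 0 ≤ r * u 0 + s * u 1 := by
  simp [Fin.forall_fin_two, Matrix.mulVec, dotProduct, Fin.sum_univ_two]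

/-- The determinant is `1` at the inner vertices but `±(d - 1)` at the two ends, so a unimodular
change of variables would not suffice. -/
theorem vertexForms_det_ne_zero (hd : 3 ≤ d) (j : Fin (d + 1)) : (vertexForms d j).det ≠ 0 := by
  unfold vertexForms
  split_ifs <;> rw [Matrix.det_fin_two] <;> simp <;> lia

theorem vertexForms_nonneg (j : Fin (d + 1)) {u : Fin 2 → ℤ} (hu : InPolygon d u) :
    ∀ r, 0 ≤ (vertexForms d j).mulVec (u - secondInterpolant d j) r := by
  have h1 := two_mul_secondInterpolant_one j
  obtain ⟨h0, hd, hlo, hhi⟩ := hu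
  unfold vertexForms
  split_ifs with hj hj' <;> rw [mulVec_fin_two] <;>
    simp only [Pi.sub_apply, secondInterpolant_zero]
  · subst hj
    simp only [Fin.val_zero] at h1 ⊢
    push_cast at h1 ⊢
    have := mul_pred_nonneg (u 0)
    constructor <;> linarith
  · subst hj'
    simp only [Fin.val_last] at h1 ⊢
    have := mul_pred_nonneg (d - u 0)
    constructor <;> linarith
  · have := mul_pred_nonneg (u 0 - j)
    have := mul_pred_nonneg (j - u 0)
    constructor <;> linarith

theorem mem_closure_vertex_cone (hd : 3 ≤ d) (j : Fin (d + 1)) (u : Fin 2 → ℤ)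
    (hu : ∀ r, 0 ≤ (vertexForms d j).mulVec u r) :
    u ∈ AddSubmonoid.closure (Set.range fun k : latticePoints (secondInterpolant d) =>
      saturation (secondInterpolant d) k -
        saturation (secondInterpolant d) (toSaturation (secondInterpolant d) j)) := by
  set S := AddSubmonoid.closure (Set.range fun k : latticePoints (secondInterpolant d) =>
      saturation (secondInterpolant d) k -
        saturation (secondInterpolant d) (toSaturation (secondInterpolant d) j))
  have hd' : (3 : ℤ) ≤ d := by exact_mod_cast hd
  have hmem : ∀ w : Fin 2 → ℤ, InPolygon d (w + secondInterpolant d j) → w ∈ S := fun w hw =>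
    AddSubmonoid.subset_closure ⟨⟨_, mem_latticePoints_iff.2 hw⟩, by
      simp [saturation, toSaturation]⟩
  have h1 := two_mul_secondInterpolant_one j
  have huv : u = ![u 0, u 1] := by ext r; fin_cases r <;> rfl
  unfold vertexForms at hu
  split_ifs at hu with hj hj' <;> rw [mulVec_fin_two] at hu
  · let φ : ℤ × ℤ →+ (Fin 2 → ℤ) := AddMonoidHom.mk' (fun p => ![p.1, p.2]) (by simp)
    subst hj
    simp only [Fin.val_zero] at h1
    push_cast at h1
    have hn : 0 ≤ u 0 := by nlinarith
    obtain ⟨n, hn⟩ := Int.eq_ofNat_of_zero_le hn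
    have := mem_of_vertex_cone hd (S.comap φ) (fun y hy hy' => hmem _ ?_)
      (fun y hy hy' => hmem _ ?_) n (u 1) (by linarith) (by rw [hn] at hu; linarith)
    · rw [huv, hn]
      exact this
    all_goals
      simp only [InPolygon, Pi.add_apply, φ, AddMonoidHom.mk'_apply, Matrix.cons_val_zero,
        Matrix.cons_val_one, secondInterpolant_zero, Fin.val_zero]
      push_cast
      refine ⟨trivial, ?_, ?_, ?_⟩ <;> linarith
  -- `φ` is the linear part of the affine symmetry of the polygon exchanging the vertices `j` and `d
  -- - j`; it carries the cone at `0` to the cone at `d`.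
  · let φ : ℤ × ℤ →+ (Fin 2 → ℤ) := AddMonoidHom.mk' (fun p => ![-p.1, p.2 - (d - 1) * p.1])
      (fun p q => by ext r; fin_cases r <;> simp <;> ring)
    subst hj'
    simp only [Fin.val_last] at h1
    have hn : 0 ≤ -u 0 := by nlinarith
    obtain ⟨n, hn⟩ := Int.eq_ofNat_of_zero_le hn
    have hn : -u 0 = (n : ℤ) := hn
    have := mem_of_vertex_cone hd (S.comap φ) (fun y hy hy' => hmem _ ?_)
      (fun y hy hy' => hmem _ ?_) n (u 1 + (d - 1) * n) (by rw [← hn]; linarith)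
      (by rw [← hn]; linarith)
    · have h : φ (n, u 1 + (d - 1) * n) = u := by
        ext r
        fin_cases r
        · simp [φ, ← hn]
        · simp [φ]
      rw [← h]
      exact this
    all_goals
      simp only [InPolygon, Pi.add_apply, φ, AddMonoidHom.mk'_apply, Matrix.cons_val_zero,
        Matrix.cons_val_one, secondInterpolant_zero, Fin.val_last]
      refine ⟨?_, ?_, ?_, ?_⟩ <;> linarith
  · have hj0 : 0 < (j : ℕ) := Fin.pos_iff_ne_zero.2 hj
    have hjd : (j : ℕ) < d := lt_of_le_of_ne (Nat.lt_succ_iff.1 j.2) fun h => hj' (Fin.ext h)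
    have hj0' : (1 : ℤ) ≤ j := by exact_mod_cast hj0
    have hjd' : (j : ℤ) + 1 ≤ d := by exact_mod_cast hjd
    -- The vectors to the two neighbouring vertices form a lattice basis dual to the two forms.
    have e1 : ![1, (j : ℤ)] ∈ S := hmem _ (by
      simp only [InPolygon, Pi.add_apply, Matrix.cons_val_zero, Matrix.cons_val_one,
        secondInterpolant_zero]
      refine ⟨?_, ?_, ?_, ?_⟩ <;> nlinarith)
    have e2 : ![-1, 1 - (j : ℤ)] ∈ S := hmem _ (by
      simp only [InPolygon, Pi.add_apply, Matrix.cons_val_zero, Matrix.cons_val_one,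
        secondInterpolant_zero]
      refine ⟨?_, ?_, ?_, ?_⟩ <;> nlinarith)
    obtain ⟨α, hα⟩ := Int.eq_ofNat_of_zero_le hu.1
    obtain ⟨β, hβ⟩ := Int.eq_ofNat_of_zero_le hu.2
    have : u = α • ![1, (j : ℤ)] + β • ![-1, 1 - (j : ℤ)] := by
      have hα : (1 - (j : ℤ)) * u 0 + 1 * u 1 = α := hα
      have hβ : -(j : ℤ) * u 0 + 1 * u 1 = β := hβ
      ext r
      fin_cases r
      · simp
        rw [← hα, ← hβ]
        ring
      · simp
        rw [← hα, ← hβ]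
        ring
    rw [this]
    exact add_mem (nsmul_mem e1 α) (nsmul_mem e2 β)


/-! ### The number of lattice points -/

/-- The lattice points of the polygon, column by column. -/
def polygonColumns (d : ℕ) : Finset (Σ _ : ℕ, ℕ) :=
  (Finset.range (d + 1)).sigma fun x => Finset.Icc (x.choose 2) (x * (d - 1) / 2)

theorem latticePoints_eq_image {d : ℕ} (hd : 1 ≤ d) :
    latticePoints (secondInterpolant d) =
      (fun p : Σ _ : ℕ, ℕ => ![(p.1 : ℤ), (p.2 : ℤ)]) '' (polygonColumns d : Set (Σ _ : ℕ, ℕ)) := by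
  ext u
  rw [mem_latticePoints_iff]
  have key : ∀ x y : ℕ, (⟨x, y⟩ : Σ _ : ℕ, ℕ) ∈ polygonColumns d ↔
      InPolygon d ![(x : ℤ), (y : ℤ)] := fun x y => by
    have h2 := two_mul_choose_two x
    simp only [polygonColumns, Finset.mem_sigma, Finset.mem_range, Finset.mem_Icc, InPolygon,
      Matrix.cons_val_zero, Matrix.cons_val_one, Nat.le_div_iff_mul_le two_pos]
    rw [← h2]
    zify [hd]
    constructor
    · rintro ⟨h1, h2, h3⟩
      exact ⟨by lia, by lia, by lia, by lia⟩
    · rintro ⟨h0, h1, h2, h3⟩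
      exact ⟨by lia, by lia, by lia⟩
  constructor
  · intro hu
    obtain ⟨x, hx⟩ := Int.eq_ofNat_of_zero_le hu.1
    obtain ⟨y, hy⟩ := Int.eq_ofNat_of_zero_le (show 0 ≤ u 1 by
      linarith [hu.2.2.1, mul_pred_nonneg (u 0)])
    have : u = ![(x : ℤ), (y : ℤ)] := by
      ext r
      fin_cases r
      · exact hx
      · exact hy
    rw [this] at hu ⊢
    exact ⟨⟨x, y⟩, (key x y).2 hu, rfl⟩
  · rintro ⟨⟨x, y⟩, hp, rfl⟩
    exact (key x y).1 hp

theorem latticePoints_finite {d : ℕ} (hd : 1 ≤ d) :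
    (latticePoints (secondInterpolant d)).Finite := by
  rw [latticePoints_eq_image hd]
  exact (Finset.finite_toSet _).image _

theorem card_latticePoints {d : ℕ} (hd : 1 ≤ d) :
    Nat.card (latticePoints (secondInterpolant d)) =
      ∑ x ∈ Finset.range (d + 1), (x * (d - 1) / 2 + 1 - x.choose 2) := by
  rw [latticePoints_eq_image hd, Nat.card_coe_set_eq, Set.ncard_image_of_injective,
    Set.ncard_coe_finset, polygonColumns, Finset.card_sigma]
  · simp only [Nat.card_Icc]
  · rintro ⟨x, y⟩ ⟨x', y'⟩ h
    have h0 := congrFun h 0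
    have h1 := congrFun h 1
    simp only [Matrix.cons_val_zero, Matrix.cons_val_one, Nat.cast_inj] at h0 h1
    subst h0 h1
    rfl

theorem choose_two_le {x d : ℕ} (h : x < d + 1) : x.choose 2 ≤ x * (d - 1) / 2 := by
  rw [Nat.choose_two_right]
  exact Nat.div_le_div_right (Nat.mul_le_mul_left _ (by lia))

theorem cast_choose_two (n : ℕ) : (n.choose 2 : ℚ) = n * (n - 1) / 2 := by
  have := two_mul_choose_two n
  have : 2 * (n.choose 2 : ℚ) = n * (n - 1) := by exact_mod_cast this
  linarith

theorem card_latticePoints_of_odd {d : ℕ} (hd : Odd d) :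
    (Nat.card (latticePoints (secondInterpolant d)) : ℚ) =
      (d : ℚ) * ((d : ℚ) ^ 2 + 11) / 12 + 1 := by
  obtain ⟨m, rfl⟩ := hd
  have key : ∀ n : ℕ, ∑ x ∈ Finset.range n, ((x : ℚ) * m + 1 - x.choose 2) =
      n * (n - 1) / 2 * m + n - n * (n - 1) * (n - 2) / 6 := fun n => by
    induction n with
    | zero => simp
    | succ n ih =>
      rw [Finset.sum_range_succ, ih, cast_choose_two]
      push_cast
      ring
  rw [card_latticePoints (by lia), Nat.cast_sum]
  have : ∀ x ∈ Finset.range (2 * m + 1 + 1),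
      ((x * (2 * m + 1 - 1) / 2 + 1 - x.choose 2 : ℕ) : ℚ) = (x : ℚ) * m + 1 - x.choose 2 := by
    intro x hx
    rw [Nat.cast_sub ((choose_two_le (Finset.mem_range.1 hx)).trans (Nat.le_succ _))]
    have : x * (2 * m + 1 - 1) / 2 = x * m := by
      rw [Nat.add_sub_cancel, mul_left_comm, Nat.mul_div_cancel_left _ two_pos]
    rw [this]
    push_cast
    ring
  rw [Finset.sum_congr rfl this, key]
  push_cast
  ring

theorem card_latticePoints_of_even {d : ℕ} (hd : Even d) (hd1 : 1 ≤ d) :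
    (Nat.card (latticePoints (secondInterpolant d)) : ℚ) =
      (d : ℚ) * ((d : ℚ) ^ 2 + 8) / 12 + 1 := by
  obtain ⟨m, rfl⟩ := hd
  -- For `d = 2m` the upper edge at `x` rounds down to `x * m - ⌈x / 2⌉`. Adding two columns at a
  -- time avoids a case split on the parity of `x`.
  have key : ∀ n : ℕ, ∑ x ∈ Finset.range (2 * n + 1),
      ((x : ℚ) * m - ((x + 1) / 2 : ℕ) + 1 - x.choose 2) =
      (2 * n + 1) * n * m - n * (n + 1) + (2 * n + 1) - (2 * n + 1) * n * (2 * n - 1) / 3 :=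
    fun n => by
    induction n with
    | zero => simp
    | succ n ih =>
      rw [show 2 * (n + 1) + 1 = 2 * n + 1 + 1 + 1 by ring, Finset.sum_range_succ,
        Finset.sum_range_succ, ih, cast_choose_two, cast_choose_two,
        show (2 * n + 1 + 1) / 2 = n + 1 by lia, show (2 * n + 1 + 1 + 1) / 2 = n + 1 by lia]
      push_cast
      ring
  rw [card_latticePoints hd1, Nat.cast_sum, ← two_mul]
  have : ∀ x ∈ Finset.range (2 * m + 1),
      ((x * (2 * m - 1) / 2 + 1 - x.choose 2 : ℕ) : ℚ) =
        (x : ℚ) * m - ((x + 1) / 2 : ℕ) + 1 - x.choose 2 := by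
    intro x hx
    rw [Nat.cast_sub ((choose_two_le (Finset.mem_range.1 hx)).trans (Nat.le_succ _))]
    have hle : x * (2 * m - 1) / 2 + (x + 1) / 2 = x * m := by
      have h1 : x * (2 * m - 1) + x = 2 * (x * m) := by
        have : 2 * m - 1 + 1 = 2 * m := by lia
        calc x * (2 * m - 1) + x = x * (2 * m - 1 + 1) := by ring
          _ = 2 * (x * m) := by rw [this]; ring
      lia
    have : ((x * (2 * m - 1) / 2 : ℕ) : ℚ) = x * m - ((x + 1) / 2 : ℕ) := by
      rw [eq_sub_iff_add_eq]
      exact_mod_cast hle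
    rw [Nat.cast_succ, this]
  rw [Finset.sum_congr rfl this, key]
  push_cast
  ring

/-! ### The normalization of the second interpolant -/

theorem secondInterpolant_normalization {d : ℕ} (hd : 3 ≤ d) :
    ∃ H : ProjectsOnto (toSaturation (secondInterpolant d))
        (toricVariety (saturation (secondInterpolant d)))
        (toricVariety (secondInterpolant d)),
      H.IsToric (saturation (secondInterpolant d)) (secondInterpolant d) ∧
      H.IsNormalization := by
  have hσ : ∀ k, saturation (secondInterpolant d) (toSaturation (secondInterpolant d) k) =
      secondInterpolant d k := fun _ => rfl
  have hinj : Function.Injective (toSaturation (secondInterpolant d)) := fun i j h =>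
    secondInterpolant_injective (congrArg Subtype.val h)
  have hconv : ∀ u : latticePoints (secondInterpolant d), ∃ c : Fin (d + 1) → ℕ, 0 < ∑ k, c k ∧
      (∑ k, c k) • saturation (secondInterpolant d) u = ∑ k, c k • secondInterpolant d k :=
    fun u => exists_convex_combination (mem_latticePoints_iff.1 u.2)
  have hpos : ∀ (j : Fin (d + 1)) (u : latticePoints (secondInterpolant d)) r,
      0 ≤ (vertexForms d j).mulVec (saturation (secondInterpolant d) u -
        saturation (secondInterpolant d) (toSaturation (secondInterpolant d) j)) r :=
    fun j u => vertexForms_nonneg j (mem_latticePoints_iff.1 u.2)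
  refine ⟨projectsOnto_toricVariety hinj hσ hconv fun j =>
    ⟨_, vertexForms_det_ne_zero hd j, hpos j⟩, ?_, ?_⟩
  · exact fun t p hp => ⟨torusAct_mem_toricVariety t hp, coordProj_torusAct hσ t p⟩
  · intro j
    have := (latticePoints_finite (d := d) (by lia)).to_subtype
    refine isAffineNormalization_comorphism _ hσ (vertexForms_det_ne_zero hd j) (hpos j)
      (mem_closure_vertex_cone hd j) (fun u => ?_) fun u => exists_group_combination hd _ _
    obtain ⟨c, hc0, hc⟩ := hconv u
    refine ⟨_, hc0, c, ?_⟩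
    rw [smul_sub, hc]
    simp only [smul_sub, Finset.sum_sub_distrib, Finset.sum_smul, hσ]


/-! ### Sumsets have polynomial growth -/

/-- The number `N n` is a polynomial in `n` for all large `n`. -/
def EventuallyPolynomial (N : ℕ → ℕ) : Prop :=
  ∃ P : Polynomial ℚ, ∀ᶠ n : ℕ in Filter.atTop, (N n : ℚ) = P.eval (n : ℚ)

/-- The tuples of `k` natural numbers with sum `n`. -/
abbrev compositions (k n : ℕ) : Finset (Fin k → ℕ) := Finset.piAntidiag Finset.univ n

theorem mem_compositions {k n : ℕ} {c : Fin k → ℕ} : c ∈ compositions k n ↔ ∑ i, c i = n := by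
  simp [compositions]

theorem card_compositions (k n : ℕ) : (compositions (k + 1) n).card = (n + k).choose k := by
  rw [compositions, ← Finset.map_sym_eq_piAntidiag, Finset.card_map, Finset.sym_univ,
    Finset.card_univ, Sym.card_sym_eq_choose, Fintype.card_fin, add_right_comm, Nat.add_sub_cancel,
    add_comm k n, Nat.choose_symm_add]

open Classical in
theorem card_filter_le_compositions {k n : ℕ} (m : Fin k → ℕ) (h : ∑ i, m i ≤ n) :
    ((compositions k n).filter (m ≤ ·)).card = (compositions k (n - ∑ i, m i)).card := by
  symm
  refine Finset.card_bij (fun c _ => c + m) (fun c hc => ?_) (fun c _ c' _ h => add_right_cancel h)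
    fun c hc => ?_
  · rw [mem_compositions] at hc
    rw [Finset.mem_filter, mem_compositions]
    refine ⟨?_, le_add_self⟩
    simp only [Pi.add_apply, Finset.sum_add_distrib, hc]
    lia
  · rw [Finset.mem_filter, mem_compositions] at hc
    refine ⟨c - m, ?_, tsub_add_cancel_of_le hc.2⟩
    rw [mem_compositions]
    have : ∑ i, (c - m) i + ∑ i, m i = n := by
      rw [← Finset.sum_add_distrib, ← hc.1]
      exact Finset.sum_congr rfl fun i _ => tsub_add_cancel_of_le (hc.2 i)
    lia

/-- Dickson's lemma: the minimal elements form an antichain, which is finite by well-quasi-ordering.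
-/
theorem exists_finset_generating {k : ℕ} {S : Set (Fin k → ℕ)} (hS : IsUpperSet S) :
    ∃ T : Finset (Fin k → ℕ), ∀ c, c ∈ S ↔ ∃ m ∈ T, m ≤ c := by
  have hfin := WellQuasiOrderedLE.finite_of_isAntichain (setOfPred_minimal_antichain (· ∈ S))
  refine ⟨hfin.toFinset, fun c => ⟨fun hc => ?_, ?_⟩⟩
  · obtain ⟨m, hmc, hm⟩ := exists_minimal_le_of_wellFoundedLT (· ∈ S) c hc
    exact ⟨m, hfin.mem_toFinset.2 hm, hmc⟩
  · rintro ⟨m, hm, hmc⟩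
    exact hS hmc (hfin.mem_toFinset.1 hm).prop

-- Inclusion–exclusion over the generators: orthants with corners `m` meet in the orthant whose
-- corner is the join. Each contributes a binomial coefficient, polynomial once `n` exceeds the
-- coordinate sum of the largest join.
open Classical in
theorem eventuallyPolynomial_card_upperSet {k : ℕ} {S : Set (Fin (k + 1) → ℕ)}
    (hS : IsUpperSet S) :
    EventuallyPolynomial fun n => ((compositions (k + 1) n).filter (· ∈ S)).card := by
  obtain ⟨T, hT⟩ := exists_finset_generating hS
  refine ⟨∑ t : T.powerset.filter (·.Nonempty), ((-1 : ℚ) ^ (t.1.card + 1)) •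
    Polynomial.preHilbertPoly ℚ k (∑ i, t.1.sup id i), ?_⟩
  filter_upwards [Filter.eventually_ge_atTop (∑ i, T.sup id i)] with n hn
  have hunion : (compositions (k + 1) n).filter (· ∈ S) =
      T.biUnion fun m => (compositions (k + 1) n).filter (m ≤ ·) := by
    ext c
    simp only [Finset.mem_filter, hT, Finset.mem_biUnion]
    tauto
  have hcast := congrArg (Int.cast : ℤ → ℚ) (Finset.inclusion_exclusion_card_biUnion T
    fun m => (compositions (k + 1) n).filter (m ≤ ·))
  rw [Int.cast_natCast] at hcast
  rw [hunion, hcast, Int.cast_sum, Polynomial.eval_finsetSum]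
  refine Finset.sum_congr rfl fun t _ => ?_
  have htT : t.1 ⊆ T := Finset.mem_powerset.1 (Finset.mem_filter.1 t.2).1
  have hne : t.1.Nonempty := (Finset.mem_filter.1 t.2).2
  have hle : ∑ i, t.1.sup id i ≤ n :=
    (Finset.sum_le_sum fun i _ => Finset.sup_mono (f := id) htT i).trans hn
  have hinf : t.1.inf' hne (fun m => (compositions (k + 1) n).filter (m ≤ ·)) =
      (compositions (k + 1) n).filter (t.1.sup id ≤ ·) := by
    ext c
    simp only [Finset.mem_inf', Finset.mem_filter, Finset.sup_le_iff, id]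
    obtain ⟨m, hm⟩ := hne
    exact ⟨fun h => ⟨(h m hm).1, fun m' hm' => (h m' hm').2⟩, fun h m' hm' => ⟨h.1, h.2 m' hm'⟩⟩
  rw [hinf, card_filter_le_compositions _ hle, card_compositions, Polynomial.eval_smul,
    Polynomial.preHilbertPoly_eq_choose_sub_add ℚ k hle]
  push_cast
  rfl

theorem EventuallyPolynomial.sub {N N' : ℕ → ℕ} (h : EventuallyPolynomial N)
    (h' : EventuallyPolynomial N') (hle : ∀ n, N' n ≤ N n) :
    EventuallyPolynomial fun n => N n - N' n := by
  obtain ⟨P, hP⟩ := h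
  obtain ⟨Q, hQ⟩ := h'
  refine ⟨P - Q, ?_⟩
  filter_upwards [hP, hQ] with n hn hn'
  rw [Nat.cast_sub (hle n), hn, hn', Polynomial.eval_sub]

/-- The sums of `n` elements of a finite configuration. -/
def sumset {k : ℕ} {M : Type*} [AddCommMonoid M] [DecidableEq M] (e : Fin k → M) (n : ℕ) :
    Finset M :=
  (compositions k n).image fun c => ∑ i, c i • e i

theorem mem_sumset {k : ℕ} {M : Type*} [AddCommMonoid M] [DecidableEq M] {e : Fin k → M} {n : ℕ}
    {u : M} : u ∈ sumset e n ↔ ∃ c : Fin k → ℕ, ∑ i, c i = n ∧ ∑ i, c i • e i = u := by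
  simp [sumset]

/-- Each sum has a unique lexicographically least composition. The non-minimal compositions `S` form
an upper set, since adding the same tuple to both sides preserves a comparison. This is the passage
to the initial ideal. -/
theorem eventuallyPolynomial_card_sumset {k : ℕ} {M : Type*} [AddCommMonoid M] [DecidableEq M]
    (e : Fin (k + 1) → M) : EventuallyPolynomial fun n => (sumset e n).card := by
  classical
  set val : (Fin (k + 1) → ℕ) → M := fun c => ∑ i, c i • e i with hval
  set S : Set (Fin (k + 1) → ℕ) := {c | ∃ c' : Fin (k + 1) → ℕ, toLex c' < toLex c ∧
    ∑ i, c' i = ∑ i, c i ∧ val c' = val c}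
  have hup : IsUpperSet S := by
    rintro c d hcd ⟨c', hlt, hsum, hv⟩
    obtain ⟨g, rfl⟩ := exists_add_of_le hcd
    refine ⟨c' + g, ?_, ?_, ?_⟩
    · rw [toLex_add, toLex_add]
      exact add_lt_add_left hlt _
    · simp [Finset.sum_add_distrib, hsum]
    · have : ∀ c, val (c + g) = val c + val g := fun c => by
        simp [hval, add_smul, Finset.sum_add_distrib]
      rw [this, this, hv]
  have huniv : EventuallyPolynomial fun n => (compositions (k + 1) n).card := by
    have := eventuallyPolynomial_card_upperSet (k := k) isUpperSet_univ
    simpa using this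
  convert huniv.sub (eventuallyPolynomial_card_upperSet hup)
    (fun n => Finset.card_filter_le _ _) using 2 with n
  have hsplit := Finset.card_filter_add_card_filter_not (s := compositions (k + 1) n) (· ∈ S)
  have himage : sumset e n = ((compositions (k + 1) n).filter (· ∉ S)).image val := by
    ext v
    rw [Finset.mem_image]
    refine ⟨fun h => ?_, ?_⟩
    · obtain ⟨c, hc, rfl⟩ := Finset.mem_image.1 h
      obtain ⟨c₀, hc₀, hmin⟩ := Finset.exists_min_image
        ((compositions (k + 1) n).filter fun c' => val c' = val c) toLex
        ⟨c, Finset.mem_filter.2 ⟨hc, rfl⟩⟩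
      rw [Finset.mem_filter] at hc₀
      refine ⟨c₀, Finset.mem_filter.2 ⟨hc₀.1, ?_⟩, hc₀.2⟩
      rintro ⟨c', hlt, hsum, hv⟩
      refine (hmin c' (Finset.mem_filter.2 ⟨?_, hv.trans hc₀.2⟩)).not_gt hlt
      rw [mem_compositions, hsum]
      exact mem_compositions.1 hc₀.1
    · rintro ⟨c, hc, rfl⟩
      exact Finset.mem_image_of_mem _ (Finset.mem_filter.1 hc).1
  rw [himage, Finset.card_image_of_injOn]
  · lia
  · intro c hc c' hc' h
    simp only [Finset.coe_filter, mem_compositions, Set.mem_ofPred_eq] at hc hc'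
    by_contra hne
    rcases lt_or_gt_of_ne (fun h => hne (toLex.injective h) : toLex c ≠ toLex c') with hlt | hlt
    · exact hc'.2 ⟨c, hlt, hc.1.trans hc'.1.symm, h⟩
    · exact hc.2 ⟨c', hlt, hc'.1.trans hc.1.symm, h.symm⟩

/-! ### The Hilbert function of a projective toric surface -/

theorem mem_idealInDegree_iff {ι : Type*} [Nonempty ι] {b : ι → Fin 2 → ℤ} {e : ι → Fin 2 →₀ ℕ}
    (he : ∀ k r, (e k r : ℤ) = b k r) {n : ℕ} (f : MvPolynomial.homogeneousSubmodule ι ℂ n) :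
    f ∈ idealInDegree (toricVariety b) n ↔ monomialMap e (f : MvPolynomial ι ℂ) = 0 := by
  have hf : (f : MvPolynomial ι ℂ).IsHomogeneous n := f.2
  rw [monomialMap_eq_zero_iff]
  have hvec : ∀ s : Fin 2 → ℂˣ, (fun k => MvPolynomial.eval (fun i => (s i : ℂ))
      (MvPolynomial.monomial (e k) 1)) = monomialVec b s := fun s =>
    funext fun k => eval_units_monomial s (e k) _ (he k)
  simp only [hvec]
  constructor
  · intro h t
    exact (Projectivization.eval_rep_eq_zero_iff hf _ _).1 (h _ (mk_monomialVec_mem b t))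
  · intro h p hp
    exact (mem_toricVariety_iff b p).1 hp n _ hf h

/-- Within a fixed degree no homogenizing variable is needed: the monomial map has the ideal as
kernel and the monomials with exponents in the sumset as a basis of its image. -/
theorem hilbertFunction_toricVariety {k : ℕ} {b : Fin (k + 1) → Fin 2 → ℤ}
    {e : Fin (k + 1) → Fin 2 →₀ ℕ} (he : ∀ k r, (e k r : ℤ) = b k r) (n : ℕ) :
    hilbertFunction (toricVariety b) n = (sumset e n).card := by
  classical
  let L : MvPolynomial.homogeneousSubmodule (Fin (k + 1)) ℂ n →ₗ[ℂ] MvPolynomial (Fin 2) ℂ :=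
    (monomialMap e).toLinearMap ∘ₗ Submodule.subtype _
  have hker : idealInDegree (toricVariety b) n = LinearMap.ker L := by
    ext f
    rw [mem_idealInDegree_iff he, LinearMap.mem_ker]
    rfl
  have hsum : ∀ c : Fin (k + 1) →₀ ℕ, (c.sum fun k n => n • e k) = ∑ i, c i • e i := fun c =>
    Finsupp.sum_fintype _ _ fun _ => zero_smul _ _
  have hrange : LinearMap.range L = Submodule.span ℂ
      (((sumset e n).image fun m => MvPolynomial.monomial m (1 : ℂ) :
        Finset (MvPolynomial (Fin 2) ℂ)) : Set (MvPolynomial (Fin 2) ℂ)) := by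
    apply le_antisymm
    · rintro _ ⟨⟨f, hf⟩, rfl⟩
      change monomialMap e f ∈ _
      rw [f.as_sum, map_sum]
      refine Submodule.sum_mem _ fun c hc => ?_
      have hc : ∑ i, c i = n := by
        have := hf (MvPolynomial.mem_support_iff.1 hc)
        rw [← this, Finsupp.weight_apply, Finsupp.sum_fintype _ _ (by simp)]
        simp
      rw [monomialMap_monomial, ← mul_one (MvPolynomial.coeff c f), ← smul_eq_mul,
        ← MvPolynomial.smul_monomial, hsum]
      refine Submodule.smul_mem _ _ (Submodule.subset_span ?_)
      rw [Finset.coe_image]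
      exact ⟨_, mem_sumset.2 ⟨c, hc, rfl⟩, rfl⟩
    · rw [Submodule.span_le, Finset.coe_image]
      rintro _ ⟨v, hv, rfl⟩
      obtain ⟨c, hc, rfl⟩ := mem_sumset.1 hv
      refine ⟨⟨MvPolynomial.monomial (Finsupp.equivFunOnFinite.symm c) 1,
        MvPolynomial.isHomogeneous_monomial _ ?_⟩, ?_⟩
      · rw [Finsupp.degree_eq_sum]
        exact hc
      · change monomialMap e (MvPolynomial.monomial (Finsupp.equivFunOnFinite.symm c) 1) = _
        rw [monomialMap_monomial, hsum]
        rfl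
  have hinj : Function.Injective fun m : Fin 2 →₀ ℕ => MvPolynomial.monomial m (1 : ℂ) := by
    rw [← MvPolynomial.coe_basisMonomials]
    exact (MvPolynomial.basisMonomials (Fin 2) ℂ).injective
  rw [hilbertFunction, hker, (LinearMap.quotKerEquivRange L).finrank_eq, hrange,
    finrank_span_finset_eq_card, Finset.card_image_of_injective _ hinj]
  rw [Finset.coe_image]
  have := (MvPolynomial.basisMonomials (Fin 2) ℂ).linearIndependent.linearIndepOn_id
  refine this.mono ?_
  rintro _ ⟨m, -, rfl⟩
  exact ⟨m, by rw [MvPolynomial.coe_basisMonomials]⟩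


/-! ### The leading term of the Hilbert polynomial -/

theorem natDegree_leadingCoeff_of_quadratic_growth {P : Polynomial ℚ} {α B : ℚ} (hα : α ≠ 0)
    (h : ∀ᶠ n : ℕ in Filter.atTop, |P.eval (n : ℚ) - α * n ^ 2| ≤ B * n) :
    P.natDegree = 2 ∧ P.leadingCoeff = α := by
  set R : Polynomial ℚ := P - Polynomial.C α * Polynomial.X ^ 2 with hR
  have hdeg : R.degree ≤ (Polynomial.X : Polynomial ℚ).degree := by
    by_contra! hlt
    have htend := (Polynomial.abs_div_tendsto_atTop_atTop_of_degree_gt R Polynomial.X hlt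
      Polynomial.X_ne_zero).comp (tendsto_natCast_atTop_atTop (R := ℚ))
    obtain ⟨n, hn, hn', hn0⟩ := ((htend.eventually_gt_atTop B).and
      (h.and (Filter.eventually_gt_atTop 0))).exists
    have hn0' : (0 : ℚ) < n := by exact_mod_cast hn0
    simp only [Function.comp_apply, Polynomial.eval_X, abs_div, Nat.abs_cast,
      lt_div_iff₀ hn0'] at hn
    refine hn.not_ge ?_
    simpa [hR] using hn'
  have hlt : R.degree < (Polynomial.C α * Polynomial.X ^ 2).degree := by
    rw [Polynomial.degree_C_mul_X_pow 2 hα]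
    refine hdeg.trans_lt ?_
    rw [Polynomial.degree_X]
    norm_num
  have hP : P = R + Polynomial.C α * Polynomial.X ^ 2 := by rw [hR, sub_add_cancel]
  constructor
  · rw [hP, Polynomial.natDegree_add_eq_right_of_degree_lt hlt,
      Polynomial.natDegree_C_mul_X_pow 2 α hα]
  · rw [hP, Polynomial.leadingCoeff_add_of_degree_lt hlt, Polynomial.leadingCoeff_C_mul_X_pow]

/-! ### Multiple sums of the second interpolant -/

section Sums

variable {d : ℕ}

/-- The pairs `(x, y)` which are sums of `n` elements of the second interpolant. -/
def IsSum (d n x y : ℕ) : Prop :=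
  ∃ c : Fin (d + 1) → ℕ, ∑ i, c i = n ∧ ∑ i, c i * (i : ℕ) = x ∧ ∑ i, c i * (i : ℕ).choose 2 = y

/-- The least `y` for which `(x, y)` is a sum of `n` elements of the second interpolant. -/
def lowerEnd (n x : ℕ) : ℕ := n * (x / n).choose 2 + x % n * (x / n)

theorem IsSum.two_mul_le {n x y : ℕ} (h : IsSum d n x y) : 2 * y ≤ x * (d - 1) := by
  obtain ⟨c, -, rfl, rfl⟩ := h
  rw [Finset.mul_sum, Finset.sum_mul]
  refine Finset.sum_le_sum fun i _ => ?_
  have h2 : 2 * (i : ℕ).choose 2 = (i : ℕ) * (i - 1) := by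
    rw [Nat.choose_two_right, Nat.mul_div_cancel' (Nat.even_mul_pred_self _).two_dvd]
  rw [mul_left_comm, h2, mul_assoc]
  exact Nat.mul_le_mul_left _ (Nat.mul_le_mul_left _ (by lia))

theorem IsSum.le_mul {n x y : ℕ} (h : IsSum d n x y) : x ≤ n * d := by
  obtain ⟨c, rfl, rfl, -⟩ := h
  rw [Finset.sum_mul]
  exact Finset.sum_le_sum fun i _ => Nat.mul_le_mul_left _ (Nat.lt_succ_iff.1 i.2)

/-- Sum over the summands the bound of the parabola by its chord through `q` and `q + 1`, where `q =
x / n`. -/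
theorem IsSum.lowerEnd_le {n x y : ℕ} (h : IsSum d n x y) : lowerEnd n x ≤ y := by
  obtain ⟨c, hn, hx, hy⟩ := h
  have hx' := Nat.div_add_mod x n
  rw [lowerEnd]
  set q := x / n
  set r := x % n
  have key : ∀ i : Fin (d + 1), (c i : ℤ) * (2 * q * i - q * (q + 1)) ≤
      2 * (c i * (i : ℕ).choose 2 : ℤ) := fun i => by
    have h2 := two_mul_choose_two i
    rw [mul_left_comm, h2]
    refine mul_le_mul_of_nonneg_left ?_ (Int.natCast_nonneg _)
    linarith [mul_pred_nonneg ((i : ℤ) - q)]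
  have hsum := Finset.sum_le_sum fun i (_ : i ∈ Finset.univ) => key i
  have h1 : ∑ i, (c i : ℤ) * (2 * q * i - q * (q + 1)) = 2 * q * x - q * (q + 1) * n := by
    rw [← hx, ← hn]
    push_cast
    rw [Finset.mul_sum, Finset.mul_sum, ← Finset.sum_sub_distrib]
    exact Finset.sum_congr rfl fun i _ => by ring
  have h2 : ∑ i, 2 * (c i * (i : ℕ).choose 2 : ℤ) = 2 * y := by
    rw [← hy]
    push_cast
    rw [Finset.mul_sum]
  rw [h1, h2] at hsum
  have h3 := two_mul_choose_two q
  zify at hx' ⊢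
  rw [← hx'] at hsum
  have : 2 * (n * (q.choose 2 : ℤ) + r * q) = n * (q * (q - 1)) + 2 * r * q := by
    rw [← h3]; ring
  linarith

theorem sum_single_mul (j : Fin (d + 1)) (m : ℕ) (w : Fin (d + 1) → ℕ) :
    ∑ i, (Pi.single j m : Fin (d + 1) → ℕ) i * w i = m * w j := by
  simp [Pi.single_apply]

theorem isSum_single_add_single (j k : Fin (d + 1)) (m l : ℕ) :
    IsSum d (m + l) (m * j + l * k) (m * (j : ℕ).choose 2 + l * (k : ℕ).choose 2) := by
  refine ⟨Pi.single j m + Pi.single k l, ?_, ?_, ?_⟩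
  · simp [Finset.sum_add_distrib]
  · simp only [Pi.add_apply, add_mul, Finset.sum_add_distrib, sum_single_mul]
  · simp only [Pi.add_apply, add_mul, Finset.sum_add_distrib, sum_single_mul]

theorem isSum_lowerEnd {n x : ℕ} (hn : 0 < n) (hx : x ≤ n * d) :
    IsSum d n x (lowerEnd n x) := by
  have hx' := Nat.div_add_mod x n
  have hr := Nat.mod_lt x hn
  have hq : x / n ≤ d := Nat.div_le_of_le_mul hx
  rw [lowerEnd]
  set q := x / n
  set r := x % n
  -- The minimum uses `n - r` copies of index `q` and `r` copies of `q + 1`. The latter does not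
  -- exist if `q = d`, but then `r = 0`.
  rcases hq.eq_or_lt with hq | hq
  · have hr0 : r = 0 := by
      rw [hq] at hx'
      lia
    have := isSum_single_add_single (Fin.last d) (Fin.last d) n 0
    rw [hr0] at hx' ⊢
    rw [← hx', hq]
    simpa using this
  · have := isSum_single_add_single (d := d) ⟨q, by lia⟩ ⟨q + 1, by lia⟩ (n - r) r
    rw [Nat.sub_add_cancel hr.le] at this
    have hsplit : ∀ t, n * t = (n - r) * t + r * t := fun t => by
      rw [← add_mul, Nat.sub_add_cancel hr.le]
    convert this using 1
    · refine hx'.symm.trans ?_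
      rw [hsplit]
      ring
    · rw [hsplit, Nat.choose_succ_succ' q 1, Nat.choose_one_right]
      ring

/-- Replacing two copies of index `j` by `j - 1` and `j + 1` keeps `x` and raises `y` by `1`. If no
inner index occurs twice, each index contributes at most `d ^ 2` to the gap `x * (d - 1) - 2 * y`,
contrary to `hlt`. -/
theorem IsSum.succ {n x y : ℕ} (h : IsSum d n x y)
    (hlt : 2 * y + (d + 1) * d ^ 2 < x * (d - 1)) : IsSum d n x (y + 1) := by
  obtain ⟨c, hn, hx, hy⟩ := h
  obtain ⟨j, hj0, hjd, hcj⟩ : ∃ j : Fin (d + 1), 0 < (j : ℕ) ∧ (j : ℕ) < d ∧ 2 ≤ c j := by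
    by_contra! hno
    refine hlt.not_ge ?_
    rw [← hx, ← hy, Finset.sum_mul, Finset.mul_sum]
    have hcard : (d + 1) * d ^ 2 = ∑ _i : Fin (d + 1), d ^ 2 := by simp
    rw [hcard, ← Finset.sum_add_distrib]
    refine Finset.sum_le_sum fun i _ => ?_
    have h2 : 2 * (i : ℕ).choose 2 = (i : ℕ) * (i - 1) := by
      rw [Nat.choose_two_right, Nat.mul_div_cancel' (Nat.even_mul_pred_self _).two_dvd]
    have hid := Nat.lt_succ_iff.1 i.2
    rw [mul_left_comm, h2, mul_assoc]
    rcases Nat.eq_zero_or_pos (i : ℕ) with h0 | h0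
    · simp [h0]
    rcases hid.eq_or_lt with h1 | h1
    · simp [h1]
    have hc : c i ≤ 1 := Nat.lt_succ_iff.1 (hno i h0 h1)
    have : c i * ((i : ℕ) * (d - 1)) ≤ 1 * (d * d) :=
      Nat.mul_le_mul hc (Nat.mul_le_mul hid (Nat.sub_le _ _))
    rw [one_mul, ← sq] at this
    exact this.trans (Nat.le_add_left _ _)
  obtain ⟨c₀, rfl⟩ : ∃ c₀ : Fin (d + 1) → ℕ, c = Pi.single j 2 + c₀ := by
    refine exists_add_of_le (Pi.le_def.2 fun i => ?_)
    by_cases hij : i = j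
    · subst hij
      simpa using hcj
    · simp [hij]
  have hdec : ∀ w : Fin (d + 1) → ℕ, ∑ i, (Pi.single j 2 + c₀ : Fin (d + 1) → ℕ) i * w i =
      2 * w j + ∑ i, c₀ i * w i := fun w => by
    simp only [Pi.add_apply, add_mul, Finset.sum_add_distrib, sum_single_mul]
  let j₁ : Fin (d + 1) := ⟨j - 1, by lia⟩
  let j₂ : Fin (d + 1) := ⟨j + 1, by lia⟩
  have hdec' : ∀ w : Fin (d + 1) → ℕ,
      ∑ i, (Pi.single j₁ 1 + Pi.single j₂ 1 + c₀ : Fin (d + 1) → ℕ) i * w i =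
      w j₁ + w j₂ + ∑ i, c₀ i * w i := fun w => by
    simp only [Pi.add_apply, add_mul, Finset.sum_add_distrib, sum_single_mul, one_mul]
  obtain ⟨p, hp⟩ := Nat.exists_eq_add_of_lt hj0
  have hp : (j : ℕ) = p + 1 := by lia
  refine ⟨Pi.single j₁ 1 + Pi.single j₂ 1 + c₀, ?_, ?_, ?_⟩
  · have h1 := hdec fun _ => 1
    have h2 := hdec' fun _ => 1
    simp only [mul_one] at h1 h2
    rw [h2, ← hn, h1]
  · rw [hdec', ← hx, hdec]
    simp only [j₁, j₂, hp]
    lia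
  · rw [hdec', ← hy, hdec]
    simp only [j₁, j₂, hp, Nat.add_sub_cancel]
    rw [Nat.choose_succ_succ' (p + 1) 1, Nat.choose_succ_succ' p 1, Nat.choose_one_right,
      Nat.choose_one_right]
    ring

theorem isSum_of_lowerEnd_le {n x y : ℕ} (hn : 0 < n) (hx : x ≤ n * d) (hy : lowerEnd n x ≤ y)
    (hy' : 2 * y + (d + 1) * d ^ 2 ≤ x * (d - 1)) : IsSum d n x y := by
  induction y, hy using Nat.le_induction with
  | base => exact isSum_lowerEnd hn hx
  | succ y _ ih => exact (ih (by lia)).succ (by lia)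

/-- The exponent vectors of the second interpolant. -/
noncomputable def interpolantExponent (d : ℕ) (j : Fin (d + 1)) : Fin 2 →₀ ℕ :=
  Finsupp.equivFunOnFinite.symm ![(j : ℕ), (j : ℕ).choose 2]

theorem interpolantExponent_apply (j : Fin (d + 1)) (r : Fin 2) :
    (interpolantExponent d j r : ℤ) = secondInterpolant d j r := by
  fin_cases r
  · simp [interpolantExponent, secondInterpolant_zero]
  · simp [interpolantExponent, secondInterpolant_one]

theorem mem_sumset_interpolantExponent {n : ℕ} {m : Fin 2 →₀ ℕ} :
    m ∈ sumset (interpolantExponent d) n ↔ IsSum d n (m 0) (m 1) := by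
  rw [mem_sumset]
  refine exists_congr fun c => and_congr_right fun _ => ?_
  rw [Finsupp.ext_iff, Fin.forall_fin_two]
  simp [interpolantExponent]

/-- The sums of `n` elements of the second interpolant, as pairs. -/
noncomputable def sumPairs (d n : ℕ) : Finset (Σ _ : ℕ, ℕ) :=
  (sumset (interpolantExponent d) n).image fun m => ⟨m 0, m 1⟩

theorem mem_sumPairs {n x y : ℕ} : (⟨x, y⟩ : Σ _ : ℕ, ℕ) ∈ sumPairs d n ↔ IsSum d n x y := by
  simp only [sumPairs, Finset.mem_image, mem_sumset_interpolantExponent, Sigma.mk.injEq, heq_eq_eq]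
  constructor
  · rintro ⟨m, hm, rfl, rfl⟩
    exact hm
  · intro h
    exact ⟨Finsupp.equivFunOnFinite.symm ![x, y], by simpa using h, by simp, by simp⟩

theorem card_sumPairs (d n : ℕ) :
    (sumPairs d n).card = (sumset (interpolantExponent d) n).card := by
  refine Finset.card_image_of_injective _ fun m m' h => ?_
  simp only [Sigma.mk.injEq, heq_eq_eq] at h
  ext r
  fin_cases r
  · exact h.1
  · exact h.2

theorem card_sumPairs_le {n : ℕ} (hn : 0 < n) :
    ((sumPairs d n).card : ℚ) ≤
      ∑ x ∈ Finset.range (n * d + 1), ((x * (d - 1) : ℕ) / 2 + 1 - lowerEnd n x : ℚ) := by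
  have hsub : sumPairs d n ⊆ (Finset.range (n * d + 1)).sigma
      fun x => Finset.Icc (lowerEnd n x) (x * (d - 1) / 2) := by
    rintro ⟨x, y⟩ h
    rw [mem_sumPairs] at h
    rw [Finset.mem_sigma, Finset.mem_range, Finset.mem_Icc, Nat.le_div_iff_mul_le two_pos,
      mul_comm y]
    exact ⟨Nat.lt_succ_of_le h.le_mul, h.lowerEnd_le, h.two_mul_le⟩
  refine (Nat.cast_le.2 (Finset.card_le_card hsub)).trans ?_
  rw [Finset.card_sigma, Nat.cast_sum]
  refine Finset.sum_le_sum fun x hx => ?_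
  have hle : lowerEnd n x ≤ x * (d - 1) / 2 := by
    have := (isSum_lowerEnd hn (Finset.mem_range_succ_iff.1 hx)).two_mul_le
    lia
  rw [Nat.card_Icc, Nat.cast_sub (by lia), Nat.cast_succ]
  have := Nat.cast_div_le (α := ℚ) (m := x * (d - 1)) (n := 2)
  push_cast at this ⊢
  linarith

theorem le_card_sumPairs {n : ℕ} (hn : 0 < n) :
    ∑ x ∈ Finset.range (n * d), ((x * (d - 1) : ℕ) / 2 - lowerEnd n x -
      ((d + 1) * d ^ 2 + 1) : ℚ) ≤ ((sumPairs d n).card : ℚ) := by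
  have hsub : (Finset.range (n * d)).sigma (fun x => Finset.Ico (lowerEnd n x)
      ((x * (d - 1) - (d + 1) * d ^ 2) / 2)) ⊆ sumPairs d n := by
    rintro ⟨x, y⟩ h
    rw [Finset.mem_sigma, Finset.mem_range, Finset.mem_Ico] at h
    obtain ⟨h1, h2, h3⟩ := h
    exact mem_sumPairs.2 (isSum_of_lowerEnd_le hn h1.le h2 (by dsimp only at h3 ⊢; lia))
  refine le_trans ?_ (Nat.cast_le.2 (Finset.card_le_card hsub))
  rw [Finset.card_sigma, Nat.cast_sum]
  refine Finset.sum_le_sum fun x hx => ?_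
  rw [Nat.card_Ico]
  -- The extra `1` absorbs the rounding; truncated subtraction can only enlarge the right side.
  have h1 : x * (d - 1) ≤ 2 * (((x * (d - 1) - (d + 1) * d ^ 2) / 2 - lowerEnd n x) +
      lowerEnd n x + ((d + 1) * d ^ 2 + 1)) := by lia
  have h2 : ((x * (d - 1) : ℕ) : ℚ) ≤ 2 * ((((x * (d - 1) - (d + 1) * d ^ 2) / 2 -
      lowerEnd n x : ℕ) : ℚ) + lowerEnd n x + ((d + 1) * d ^ 2 + 1)) := by exact_mod_cast h1
  linarith

theorem lowerEnd_mul_add {n : ℕ} (p r : ℕ) (hr : r < n) :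
    (lowerEnd n (n * p + r) : ℚ) = n * (p * (p - 1) / 2) + r * p := by
  rw [lowerEnd, Nat.mul_add_div (by lia), Nat.mul_add_mod, Nat.div_eq_of_lt hr,
    Nat.mod_eq_of_lt hr, add_zero]
  push_cast
  rw [cast_choose_two]

/-- In the block of columns from `n * p` to `n * (p + 1)`, `lowerEnd` is affine with slope `p`, so
each block is an arithmetic series. At `p = d` the last term vanishes and the sum is the area of `n
• Q`. -/
theorem sum_range_width (hd : 1 ≤ d) (n p : ℕ) :
    ∑ x ∈ Finset.range (n * p), ((x * (d - 1) : ℕ) / 2 - lowerEnd n x : ℚ) =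
      (n : ℚ) ^ 2 * (d * p * (p - 1) / 4 - (p - 1) * p * (2 * p - 1) / 12) +
        ((n : ℚ) ^ 2 - n) / 4 * (p * (d - p)) := by
  have inner : ∀ a b : ℚ, ∀ m : ℕ, ∑ r ∈ Finset.range m, (a + b * r) =
      a * m + b * (m * (m - 1) / 2) := fun a b m => by
    induction m with
    | zero => simp
    | succ m ih =>
      rw [Finset.sum_range_succ, ih]
      push_cast
      ring
  induction p with
  | zero => simp
  | succ p ih =>
    have hrow : ∀ r ∈ Finset.range n,
        (((n * p + r) * (d - 1) : ℕ) / 2 - lowerEnd n (n * p + r) : ℚ) =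
          (n * p * (d - 1) / 2 - n * (p * (p - 1) / 2)) + ((d - 1) / 2 - p) * r := by
      intro r hr
      rw [lowerEnd_mul_add p r (Finset.mem_range.1 hr)]
      push_cast [hd]
      ring
    rw [Nat.mul_succ, Finset.sum_range_add, ih, Finset.sum_congr rfl hrow, inner]
    push_cast
    ring

theorem abs_card_sumPairs_sub_le (hd : 1 ≤ d) {n : ℕ} (hn : 0 < n) :
    |((sumPairs d n).card : ℚ) - (((d : ℚ) + 1) * d * (d - 1) / 12) * (n : ℚ) ^ 2| ≤
      ((d : ℚ) * ((d + 1) * d ^ 2 + 1) + 1) * n := by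
  have hw := sum_range_width hd n d
  have hT : (n : ℚ) ^ 2 * (d * d * (d - 1) / 4 - (d - 1) * d * (2 * d - 1) / 12) +
        ((n : ℚ) ^ 2 - n) / 4 * (d * (d - d)) = ((d + 1) * d * (d - 1) / 12) * n ^ 2 := by
    ring
  rw [hT] at hw
  have hup := card_sumPairs_le (d := d) hn
  have hlo := le_card_sumPairs (d := d) hn
  rw [Finset.sum_sub_distrib, hw, Finset.sum_const, Finset.card_range, nsmul_eq_mul] at hlo
  have hlast := lowerEnd_mul_add d 0 hn
  rw [add_zero] at hlast
  have hup' : ∑ x ∈ Finset.range (n * d + 1), ((x * (d - 1) : ℕ) / 2 + 1 - lowerEnd n x : ℚ) =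
      ((d + 1) * d * (d - 1) / 12) * n ^ 2 + n * d + 1 := by
    rw [Finset.sum_congr rfl fun x _ => add_sub_right_comm _ _ _, Finset.sum_add_distrib,
      Finset.sum_range_succ, hw, hlast]
    simp
    push_cast [hd]
    ring
  rw [hup'] at hup
  have hn1 : (1 : ℚ) ≤ n := by exact_mod_cast hn
  have hd0 : (0 : ℚ) ≤ n * (d * ((d + 1) * d ^ 2)) := by positivity
  rw [abs_le]
  push_cast at hlo
  constructor <;> linarith

theorem hasDegree_secondInterpolant (hd : 2 ≤ d) :
    HasDegree (toricVariety (secondInterpolant d)) ((d + 1).choose 3) := by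
  obtain ⟨P, hP⟩ := eventuallyPolynomial_card_sumset (interpolantExponent d)
  have hd' : (2 : ℚ) ≤ d := by exact_mod_cast hd
  have hchoose : 6 * ((d + 1).choose 3 : ℚ) = (d + 1) * d * (d - 1) := by
    clear hP P hd hd'
    induction d with
    | zero => simp [Nat.choose]
    | succ d ih =>
      rw [Nat.choose_succ_succ' (d + 1) 2]
      push_cast
      rw [mul_add, ih, cast_choose_two]
      push_cast
      ring
  have hα : ((d : ℚ) + 1) * d * (d - 1) / 12 ≠ 0 := by
    have : (0 : ℚ) < d - 1 := by linarith
    positivity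
  obtain ⟨hdeg, hlead⟩ := natDegree_leadingCoeff_of_quadratic_growth (P := P) hα
    (B := d * ((d + 1) * d ^ 2 + 1) + 1) (by
      filter_upwards [hP, Filter.eventually_gt_atTop 0] with n hn hn0
      rw [← hn, ← card_sumPairs]
      exact abs_card_sumPairs_sub_le (by lia) hn0)
  refine ⟨P, ?_, ?_⟩
  · filter_upwards [hP] with n hn
    rw [hilbertFunction_toricVariety interpolantExponent_apply, hn]
  · rw [hdeg, hlead]
    simp only [Nat.factorial]
    push_cast
    linarith

end Sums

end ToricInterpolation

open ToricInterpolation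
theorem mainTheorem4 (d : ℕ) (hd : 3 ≤ d) :
    HasDegree (toricVariety (secondInterpolant d)) ((d + 1).choose 3) ∧
    (∃ H : ProjectsOnto (toSaturation (secondInterpolant d))
        (toricVariety (saturation (secondInterpolant d)))
        (toricVariety (secondInterpolant d)),
      H.IsToric (saturation (secondInterpolant d)) (secondInterpolant d) ∧
      H.IsNormalization) ∧
    (Even d →
      (Nat.card (latticePoints (secondInterpolant d)) : ℚ) =
        (d : ℚ) * ((d : ℚ) ^ 2 + 8) / 12 + 1) ∧
    (Odd d →
      (Nat.card (latticePoints (secondInterpolant d)) : ℚ) =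
        (d : ℚ) * ((d : ℚ) ^ 2 + 11) / 12 + 1) :=
  ⟨hasDegree_secondInterpolant (by lia), secondInterpolant_normalization hd,
    fun h => card_latticePoints_of_even h (by lia), card_latticePoints_of_odd⟩
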